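/- **Conventions.** $\mathbf{Sets}_\omega$ is the category of finite sets. A *profinite monoid* is a topological monoid whose space is compact, Hausdorff and totally disconnected; $\mathbf{Prof.Mon}$ is the category of profinite monoids and continuous homomorphisms. A *semi-galois category* is a pair $\langle\mathscr C,\mathrm F\rangle$ of an essentially small category $\mathscr C$ and a functor $\mathrm F:\mathscr C\to\mathbf{Sets}_\omega$ such that: $\mathscr C$ has an initial object $\emptyset$, a final object $1$, pullbacks and pushouts; every arrow of $\mathscr C$ is an epimorphism followed by a monomorphism; $\mathrm F(\emptyset)$ is empty and $\mathrm F(1)$ is a singleton; $\mathrm F$ preserves pullbacks and pushouts; and $\mathrm F$ reflects isomorphisms. An *exact functor* $\langle\mathscr C,\mathrm F\rangle\to\langle\mathscr C',\mathrm F'\rangle$ is a pair $\langle A,\sigma\rangle$ of a functor $A:\mathscr C\to\mathscr C'$ that preserves finite limits and finite colimits and a natural isomorphism $\sigma:\mathrm F'\circ A\Rightarrow\mathrm F$. The composite of $\langle A,\sigma\rangle$ and $\langle A',\sigma'\rangle:\langle\mathscr C',\mathrm F'\rangle\to\langle\mathscr C'',\mathrm F''\rangle$ is $\langle A'\circ A,\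 \sigma'A\cdot\sigma\rangle$ (products of natural transformations are written in diagrammatic order). Two parallel exact functors are equivalent, $\langle A,\sigma\rangle\equiv\langle B,\tau\rangle$, if there is a natural isomorphism $\lambda:A\Rightarrow B$ with $\mathrm F'\lambda\cdot\tau=\sigma$. $\mathbf{Semi\text{-}Galois}$ is the category whose objects are the semi-galois categories and whose arrows are the equivalence classes $[A,\sigma]$ of exact functors. The *fundamental monoid* $\pi_1(\mathscr C,\mathrm F)$ is the monoid $\mathrm{End}(\mathrm F)$ of natural endomorphisms of $\mathrm F$, acting on the fibers from the right ($\phi\psi$ is first $\phi$, then $\psi$), with the topology of pointwise convergence on the discrete fibers; it is a profinite monoid. An arrow $[A,\sigma]:\langle\mathscr C,\mathrm F\rangle\to\langle\mathscr C',\mathrm F'\rangle$ induces $\pi_1(\mathscr C',\mathrm F')\to\pi_1(\mathscr C,\mathrm F)$, $\phi\mapsto\sigma^{-1}\cdot\phi A\cdot\sigma$. This defines a functor $\pi_1:\mathbf{Semi\text{-}Galois}^{op}\to\mathbf{Prof.Mon}$. For a profinite monoid $M$, $\mathscr B_fM$ is the category of finite sets with a continuous right action of $M$ (the sets being discrete)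 and $M$-equivariant maps, and $\mathrm F_M$ is its forgetful functor to $\mathbf{Sets}_\omega$; $\langle\mathscr B_fM,\mathrm F_M\rangle$ is a semi-galois category. A continuous homomorphism $f:M\to M'$ induces $[\mathrm R(f),\mathrm{id}]:\langle\mathscr B_fM',\mathrm F_{M'}\rangle\to\langle\mathscr B_fM,\mathrm F_M\rangle$, where $\mathrm R(f)$ restricts actions along $f$. This defines a functor $\mathscr B_f:\mathbf{Prof.Mon}\to\mathbf{Semi\text{-}Galois}^{op}$. A *galois object* of $\langle\mathscr C,\mathrm F\rangle$ is a pair $(X,\xi)$, $\xi\in\mathrm F(X)$, such that every monomorphism $j:Z\to X$ with $\xi$ in the image of $\mathrm F(j)$ is an isomorphism, and $\mathrm{End}(X)\to\mathrm F(X)$, $u\mapsto\mathrm F(u)(\xi)$, is bijective. **Theorem (The duality theorem).** 1. The functors $\pi_1:\mathbf{Semi\text{-}Galois}^{op}\to\mathbf{Prof.Mon}$ and $\mathscr B_f:\mathbf{Prof.Mon}\to\mathbf{Semi\text{-}Galois}^{op}$ are equivalences of categories, and they are mutually inverse up to natural isomorphism: $\pi_1\circ\mathscr B_f\simeq\mathrm{id}$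 and $\mathscr B_f\circ\pi_1\simeq\mathrm{id}$. 2. For every semi-galois category $\langle\mathscr C,\mathrm F\rangle$ there is an isomorphism of topological monoids $\delta:\varprojlim_{(X,\xi)}\mathrm{End}(X)\to\pi_1(\mathscr C,\mathrm F)$ with $\xi\cdot\delta(u)_X=\mathrm F(u_{(X,\xi)})(\xi)$ for all galois objects $(X,\xi)$. Here the limit is the submonoid of $\prod_{(X,\xi)}\mathrm{End}(X)$ of all families $u$ with $l\circ u_{(X,\xi)}=u_{(X',\xi')}\circ l$ for every $l:X\to X'$ with $\mathrm F(l)(\xi)=\xi'$, with the topology induced from the product of the discrete monoids $\mathrm{End}(X)$. 3. This extends the duality between galois categories and profinite groups: for an essentially small category $\mathscr C$ and a functor $\mathrm F:\mathscr C\to\mathbf{Sets}_\omega$, the pair $\langle\mathscr C,\mathrm F\rangle$ is a galois category if and only if it is a semi-galois category and every element of $\pi_1(\mathscr C,\mathrm F)$ is invertible; and for a profinite monoid $M$, every element of $M$ is invertible if and only if $\langle\mathscr B_fM,\mathrm F_M\rangle$ is a galois category. -/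

import Mathlib

open CategoryTheory CategoryTheory.Limits Topology

universe u

/-! ### Profinite monoids -/

/-- A profinite monoid: a topological monoid whose underlying space is compact, Hausdorff and
totally disconnected. -/
structure ProfMon : Type (u + 1) where
  carrier : Type u
  [monoid : Monoid carrier]
  [topology : TopologicalSpace carrier]
  [continuousMul : ContinuousMul carrier]
  [compact : CompactSpace carrier]
  [hausdorff : T2Space carrier]
  [totallyDisconnected : TotallyDisconnectedSpace carrier]

namespace ProfMon

attribute [instance] monoid topology continuousMul compact hausdorff totallyDisconnected

instance : CoeSort ProfMon.{u} (Type u) := ⟨carrier⟩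

/-- Arrows of `ProfMon` are the continuous monoid homomorphisms. -/
instance : Category.{u} ProfMon.{u} where
  Hom M N := M →ₜ* N
  id M := ContinuousMonoidHom.id M
  comp f g := ContinuousMonoidHom.comp g f

/-- A profinite monoid is a profinite group if all its elements are invertible. -/
def IsGroup (M : ProfMon.{u}) : Prop := ∀ m : M, IsUnit m

end ProfMon

/-! ### Finite right `M`-sets -/

/-- A finite right `M`-set: a finite set with a right action of `M` which is continuous as a map
`S × M → S` for the discrete topology on `S`. -/
structure FinMSet (M : ProfMon.{u}) : Type (u + 1) where
  carrier : Type u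
  [finite : Finite carrier]
  act : carrier → M → carrier
  act_mul : ∀ (x : carrier) (m n : M), act (act x m) n = act x (m * n)
  act_one : ∀ x : carrier, act x 1 = x
  continuous_act : letI : TopologicalSpace carrier := ⊥
    Continuous fun p : carrier × M => act p.1 p.2

namespace FinMSet

attribute [instance] finite

variable {M : ProfMon.{u}}

/-- An `M`-equivariant map. -/
@[ext]
structure Hom (X Y : FinMSet M) : Type u where
  toFun : X.carrier → Y.carrier
  map_act : ∀ (x : X.carrier) (m : M), toFun (X.act x m) = Y.act (toFun x) m

/-- The category of finite right `M`-sets and `M`-equivariant maps. -/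
instance : Category.{u} (FinMSet M) where
  Hom := Hom
  id X := ⟨fun x => x, fun _ _ => rfl⟩
  comp f g := ⟨fun x => g.toFun (f.toFun x), fun x m => by rw [f.map_act, g.map_act]⟩

variable (M) in
/-- The forgetful fiber functor. -/
def fiber : FinMSet M ⥤ FintypeCat.{u} where
  obj X := FintypeCat.of X.carrier
  map f := FintypeCat.homMk f.toFun

@[ext]
lemma hom_ext {X Y : FinMSet M} {f g : X ⟶ Y} (h : ∀ x, f.toFun x = g.toFun x) : f = g :=
  Hom.ext (funext h)

instance : (fiber M).Faithful where
  map_injective {X Y f g} h := by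
    ext x
    exact ConcreteCategory.congr_hom h x

/-- The action of one element of `M`, as an arrow of finite sets. -/
def actHom (X : FinMSet M) (m : M) : (fiber M).obj X ⟶ (fiber M).obj X :=
  FintypeCat.homMk fun x => X.act x m

lemma actHom_one (X : FinMSet M) : X.actHom 1 = 𝟙 _ := by
  ext x; exact X.act_one x

lemma actHom_mul (X : FinMSet M) (m n : M) : X.actHom (m * n) = X.actHom m ≫ X.actHom n := by
  ext x; exact (X.act_mul x m n).symm

lemma actHom_naturality {X Y : FinMSet M} (f : X ⟶ Y) (m : M) :
    X.actHom m ≫ (fiber M).map f = (fiber M).map f ≫ Y.actHom m := by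
  ext x; exact f.map_act x m

lemma actHom_eventually (X : FinMSet M) (m₀ : M) : ∀ᶠ m in 𝓝 m₀, X.actHom m = X.actHom m₀ := by
  have h : ∀ x : X.carrier, ∀ᶠ m in 𝓝 m₀, X.act x m = X.act x m₀ := by
    intro x
    let _ : TopologicalSpace X.carrier := ⊥
    have : DiscreteTopology X.carrier := ⟨rfl⟩
    have hc : Continuous fun m : M => X.act x m :=
      X.continuous_act.comp (by fun_prop : Continuous fun m : M => (x, m))
    exact (hc.tendsto m₀).eventually (p := fun y => y = X.act x m₀)
      (by rw [nhds_discrete]; exact rfl)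
  filter_upwards [Filter.eventually_all.2 h] with m hm
  ext x
  exact hm x

/-- A finite set with a locally constant right action by arrows is a finite `M`-set. -/
def ofHom (S : FintypeCat.{u}) (a : M → (S ⟶ S)) (one : a 1 = 𝟙 S)
    (mul : ∀ m n, a (m * n) = a m ≫ a n)
    (loc : ∀ m₀, ∀ᶠ m in 𝓝 m₀, a m = a m₀) : FinMSet M where
  carrier := S
  act x m := a m x
  act_mul x m n := by rw [mul]; rfl
  act_one x := by rw [one]; rfl
  continuous_act := by
    let _ : TopologicalSpace S := ⊥
    have : DiscreteTopology S := ⟨rfl⟩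
    rw [continuous_iff_continuousAt]
    rintro ⟨x, m₀⟩
    have h : ∀ᶠ p in 𝓝 (x, m₀), a m₀ x = a p.2 p.1 := by
      rw [nhds_prod_eq, nhds_discrete]
      have := (Filter.Eventually.prod_mk (la := pure x) (lb := 𝓝 m₀) (pa := fun y => y = x) rfl (loc m₀))
      filter_upwards [this] with p hp
      rw [hp.1, hp.2]
    exact (tendsto_const_nhds (x := a m₀ x)).congr' h

/-- An arrow of finite sets that commutes with the actions is an arrow of `FinMSet M`. -/
def liftHom {X Y : FinMSet M} (f : (fiber M).obj X ⟶ (fiber M).obj Y)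
    (hf : ∀ m, X.actHom m ≫ f = f ≫ Y.actHom m) : X ⟶ Y where
  toFun := f
  map_act x m := ConcreteCategory.congr_hom (hf m) x

instance : (fiber M).ReflectsIsomorphisms where
  reflects {X Y} f _ := by
    refine ⟨liftHom (inv ((fiber M).map f)) fun m => ?_, ?_, ?_⟩
    · rw [IsIso.eq_inv_comp, ← Category.assoc, ← actHom_naturality, Category.assoc,
        IsIso.hom_inv_id, Category.comp_id]
    · exact (fiber M).map_injective (by
        rw [CategoryTheory.Functor.map_comp, CategoryTheory.Functor.map_id]
        exact IsIso.hom_inv_id _)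
    · exact (fiber M).map_injective (by
        rw [CategoryTheory.Functor.map_comp, CategoryTheory.Functor.map_id]
        exact IsIso.inv_hom_id _)

section limits

variable {J : Type} [SmallCategory J] (K : J ⥤ FinMSet M)

/-- One element of `M` acts on the diagram of underlying sets. -/
def actNat (m : M) : K ⋙ fiber M ⟶ K ⋙ fiber M where
  app j := (K.obj j).actHom m
  naturality _ _ f := (actHom_naturality (K.map f) m).symm

lemma actNat_one : actNat K 1 = 𝟙 _ := by
  ext1; funext j; exact actHom_one _

lemma actNat_mul (m n : M) : actNat K (m * n) = actNat K m ≫ actNat K n := by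
  ext1; funext j; exact actHom_mul _ m n

variable [FinCategory J]

lemma actNat_eventually (m₀ : M) : ∀ᶠ m in 𝓝 m₀, actNat K m = actNat K m₀ := by
  filter_upwards [Filter.eventually_all.2 fun j => actHom_eventually (K.obj j) m₀] with m hm
  ext1; funext j; exact hm j

/-- The action on a limit of the underlying sets. -/
noncomputable def limitObj : FinMSet M :=
  ofHom (limit (K ⋙ fiber M)) (fun m => limMap (actNat K m))
    (by rw [actNat_one]; exact limit.hom_ext fun j => by simp)
    (fun m n => by rw [actNat_mul]; exact limit.hom_ext fun j => by simp)
    (fun m₀ => by filter_upwards [actNat_eventually K m₀] with m hm; rw [hm])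

/-- The limit cone of `K`. -/
noncomputable def limitCone' : Cone K where
  pt := limitObj K
  π :=
    { app j := liftHom (X := limitObj K) (limit.π (K ⋙ fiber M) j) fun m => by
        exact limMap_π (actNat K m) j
      naturality i j f := (fiber M).map_injective (by
        rw [Functor.map_comp, Functor.map_comp]
        refine Eq.trans ?_ (limit.w (K ⋙ fiber M) f).symm
        exact Category.id_comp _) }

/-- The image of the limit cone is a limit cone. -/
noncomputable def isLimitMapCone : IsLimit ((fiber M).mapCone (limitCone' K)) :=
  IsLimit.ofIsoLimit (limit.isLimit (K ⋙ fiber M)) (Cone.ext (Iso.refl _) fun j => by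
    exact (Category.id_comp _).symm)

/-- The limit cone is a limit cone. -/
noncomputable def isLimitCone : IsLimit (limitCone' K) :=
  IsLimit.ofFaithful (fiber M) (isLimitMapCone K)
    (fun s => liftHom (Y := limitObj K) ((isLimitMapCone K).lift ((fiber M).mapCone s)) fun m =>
      (isLimitMapCone K).hom_ext fun j => by
        let p : limitObj K ⟶ K.obj j := (limitCone' K).π.app j
        let q : s.pt ⟶ K.obj j := s.π.app j
        let L : (fiber M).obj s.pt ⟶ (fiber M).obj (limitObj K) :=
          (isLimitMapCone K).lift ((fiber M).mapCone s)
        have h1 : L ≫ (fiber M).map p = (fiber M).map q :=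
          (isLimitMapCone K).fac ((fiber M).mapCone s) j
        change (s.pt.actHom m ≫ L) ≫ (fiber M).map p
          = (L ≫ (limitObj K).actHom m) ≫ (fiber M).map p
        rw [Category.assoc, Category.assoc, h1, actHom_naturality q, actHom_naturality p,
          ← Category.assoc, h1])
    (fun _ => rfl)

instance : HasLimit K := ⟨⟨⟨limitCone' K, isLimitCone K⟩⟩⟩

instance : PreservesLimit K (fiber M) :=
  preservesLimit_of_preserves_limit_cone (isLimitCone K) (isLimitMapCone K)

/-- The action on a colimit of the underlying sets. -/
noncomputable def colimitObj : FinMSet M :=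
  ofHom (colimit (K ⋙ fiber M)) (fun m => colimMap (actNat K m))
    (by rw [actNat_one]; exact colimit.hom_ext fun j => by simp)
    (fun m n => by rw [actNat_mul]; exact colimit.hom_ext fun j => by simp)
    (fun m₀ => by filter_upwards [actNat_eventually K m₀] with m hm; rw [hm])

/-- The colimit cocone of `K`. -/
noncomputable def colimitCocone' : Cocone K where
  pt := colimitObj K
  ι :=
    { app j := liftHom (Y := colimitObj K) (colimit.ι (K ⋙ fiber M) j) fun m => by
        exact (ι_colimMap (actNat K m) j).symm
      naturality i j f := (fiber M).map_injective (by
        rw [Functor.map_comp, Functor.map_comp]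
        refine Eq.trans (colimit.w (K ⋙ fiber M) f) ?_
        exact (Category.comp_id _).symm) }

/-- The image of the colimit cocone is a colimit cocone. -/
noncomputable def isColimitMapCocone : IsColimit ((fiber M).mapCocone (colimitCocone' K)) :=
  IsColimit.ofIsoColimit (colimit.isColimit (K ⋙ fiber M)) (Cocone.ext (Iso.refl _) fun j => by
    exact Category.comp_id _)

/-- The colimit cocone is a colimit cocone. -/
noncomputable def isColimitCocone : IsColimit (colimitCocone' K) :=
  IsColimit.ofFaithful (fiber M) (isColimitMapCocone K)
    (fun s => liftHom (X := colimitObj K)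
      ((isColimitMapCocone K).desc ((fiber M).mapCocone s)) fun m =>
      (isColimitMapCocone K).hom_ext fun j => by
        let p : K.obj j ⟶ colimitObj K := (colimitCocone' K).ι.app j
        let q : K.obj j ⟶ s.pt := s.ι.app j
        let L : (fiber M).obj (colimitObj K) ⟶ (fiber M).obj s.pt :=
          (isColimitMapCocone K).desc ((fiber M).mapCocone s)
        have h1 : (fiber M).map p ≫ L = (fiber M).map q :=
          (isColimitMapCocone K).fac ((fiber M).mapCocone s) j
        change (fiber M).map p ≫ ((colimitObj K).actHom m ≫ L)
          = (fiber M).map p ≫ (L ≫ s.pt.actHom m)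
        rw [← Category.assoc, ← Category.assoc, h1, ← actHom_naturality q, ← actHom_naturality p,
          Category.assoc, h1])
    (fun _ => rfl)

instance : HasColimit K := ⟨⟨⟨colimitCocone' K, isColimitCocone K⟩⟩⟩

instance : PreservesColimit K (fiber M) :=
  preservesColimit_of_preserves_colimit_cocone (isColimitCocone K) (isColimitMapCocone K)

end limits

instance : HasFiniteLimits (FinMSet M) := ⟨fun _ _ _ => ⟨fun _ => inferInstance⟩⟩

instance : HasFiniteColimits (FinMSet M) := ⟨fun _ _ _ => ⟨fun _ => inferInstance⟩⟩

instance : PreservesFiniteLimits (fiber M) := ⟨fun _ _ _ => ⟨inferInstance⟩⟩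

instance : PreservesFiniteColimits (fiber M) := ⟨fun _ _ _ => ⟨inferInstance⟩⟩

end FinMSet

/-! ### Semi-galois categories -/

/-- `⟨C, F⟩` satisfies the axioms of a semi-galois category. -/
structure IsSemiGalois {C : Type*} [Category* C] (F : C ⥤ FintypeCat.{u}) : Prop where
  hasInitial : HasInitial C
  hasTerminal : HasTerminal C
  hasPullbacks : HasPullbacks C
  hasPushouts : HasPushouts C
  factorization : ∀ {X Y : C} (f : X ⟶ Y), ∃ (Z : C) (p : X ⟶ Z) (j : Z ⟶ Y),
    Epi p ∧ Mono j ∧ p ≫ j = f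
  obj_initial : IsEmpty (F.obj (⊥_ C))
  obj_terminal : Nonempty (Unique (F.obj (⊤_ C)))
  preservesPullbacks : PreservesLimitsOfShape WalkingCospan F
  preservesPushouts : PreservesColimitsOfShape WalkingSpan F
  reflectsIsomorphisms : F.ReflectsIsomorphisms

/-- A semi-galois category: an essentially small category with a fiber functor. As for the category
of finite sets in `Type u`, the objects form a large type and the hom-sets lie in `Type u`. -/
structure SemiGal : Type (u + 2) where
  C : Type (u + 1)
  [category : Category.{u} C]
  [essentiallySmall : EssentiallySmall.{u} C]
  F : C ⥤ FintypeCat.{u}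
  isSemiGalois : IsSemiGalois F

attribute [instance] SemiGal.category SemiGal.essentiallySmall

/-- An exact functor between semi-galois categories. -/
structure SemiGalExactFunctor (X Y : SemiGal.{u}) : Type (u + 1) where
  A : X.C ⥤ Y.C
  [preservesFiniteLimits : PreservesFiniteLimits A]
  [preservesFiniteColimits : PreservesFiniteColimits A]
  σ : A ⋙ Y.F ≅ X.F

attribute [instance] SemiGalExactFunctor.preservesFiniteLimits SemiGalExactFunctor.preservesFiniteColimits

namespace SemiGalExactFunctor

/-- The identity exact functor. -/
def id (X : SemiGal.{u}) : SemiGalExactFunctor X X where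
  A := 𝟭 X.C
  σ := X.F.leftUnitor

/-- Composition of exact functors, `⟨A', σ'⟩ ∘ ⟨A, σ⟩ = ⟨A' ∘ A, (σ' A) · σ⟩`. -/
def comp {X Y Z : SemiGal.{u}} (f : SemiGalExactFunctor X Y) (g : SemiGalExactFunctor Y Z) :
    SemiGalExactFunctor X Z where
  A := f.A ⋙ g.A
  preservesFiniteLimits := comp_preservesFiniteLimits f.A g.A
  preservesFiniteColimits := comp_preservesFiniteColimits f.A g.A
  σ := Functor.associator f.A g.A Z.F ≪≫ Functor.isoWhiskerLeft f.A g.σ ≪≫ f.σ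

/-- `⟨A, σ⟩ ≡ ⟨B, τ⟩` if there is a natural isomorphism `l : A ≅ B` with `(F' l) · τ = σ`. -/
def Equiv {X Y : SemiGal.{u}} (f g : SemiGalExactFunctor X Y) : Prop :=
  ∃ l : f.A ≅ g.A, Functor.whiskerRight l.hom Y.F ≫ g.σ.hom = f.σ.hom

/-- Equivalence of exact functors is an equivalence relation. -/
instance setoid (X Y : SemiGal.{u}) : Setoid (SemiGalExactFunctor X Y) where
  r := Equiv
  iseqv :=
    { refl := fun f => ⟨Iso.refl _, by ext1; funext x; simp⟩
      symm := by
        rintro f g ⟨l, hl⟩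
        refine ⟨l.symm, ?_⟩
        rw [← hl]
        ext1; funext x
        simp [← Functor.map_comp_assoc]
      trans := by
        rintro f g h ⟨l, hl⟩ ⟨k, hk⟩
        refine ⟨l ≪≫ k, ?_⟩
        rw [← hl, ← hk]
        ext1; funext x
        simp }

lemma comp_equiv {X Y Z : SemiGal.{u}} (f f' : SemiGalExactFunctor X Y) (hf : f ≈ f')
    (g g' : SemiGalExactFunctor Y Z) (hg : g ≈ g') : f.comp g ≈ f'.comp g' := by
  obtain ⟨l, hl⟩ := hf
  obtain ⟨k, hk⟩ := hg
  refine ⟨Functor.isoWhiskerRight l g.A ≪≫ Functor.isoWhiskerLeft f'.A k, ?_⟩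
  ext1; funext x
  have h1 : ∀ x, Y.F.map (l.hom.app x) ≫ f'.σ.hom.app x = f.σ.hom.app x :=
    fun x => NatTrans.congr_app hl x
  have h2 : ∀ y, Z.F.map (k.hom.app y) ≫ g'.σ.hom.app y = g.σ.hom.app y :=
    fun y => NatTrans.congr_app hk y
  have h3 := g.σ.hom.naturality (l.hom.app x)
  dsimp [comp] at h3 ⊢
  simp only [Category.id_comp, Functor.map_comp, Category.assoc]
  rw [reassoc_of% (h2 (f'.A.obj x)), reassoc_of% h3, h1]

end SemiGalExactFunctor

/-- The category of semi-galois categories; its arrows are the equivalence classes of exact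
functors. -/
instance : Category.{u + 1} SemiGal.{u} where
  Hom X Y := Quotient (SemiGalExactFunctor.setoid X Y)
  id X := Quotient.mk _ (SemiGalExactFunctor.id X)
  comp := Quotient.map₂ SemiGalExactFunctor.comp fun _ _ hf _ _ hg =>
    SemiGalExactFunctor.comp_equiv _ _ hf _ _ hg
  id_comp := by
    rintro X Y ⟨f⟩
    exact Quotient.sound ⟨f.A.leftUnitor, by ext1; funext x; simp [SemiGalExactFunctor.comp, SemiGalExactFunctor.id]⟩
  comp_id := by
    rintro X Y ⟨f⟩
    exact Quotient.sound ⟨f.A.rightUnitor, by ext1; funext x; simp [SemiGalExactFunctor.comp, SemiGalExactFunctor.id]⟩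
  assoc := by
    rintro X Y Z W ⟨f⟩ ⟨g⟩ ⟨h⟩
    exact Quotient.sound ⟨Functor.associator _ _ _, by ext1; funext x; simp [SemiGalExactFunctor.comp]⟩

/-! ### The functor `M ↦ ⟨B_f M, F_M⟩` -/

namespace FinMSet

lemma epi_of_surjective {M : ProfMon.{u}} {X Y : FinMSet M} (f : X ⟶ Y)
    (hf : Function.Surjective f.toFun) : Epi f where
  left_cancellation g h e := by
    ext y
    obtain ⟨x, rfl⟩ := hf y
    exact congrFun (congrArg Hom.toFun e) x

lemma mono_of_injective {M : ProfMon.{u}} {X Y : FinMSet M} (f : X ⟶ Y)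
    (hf : Function.Injective f.toFun) : Mono f where
  right_cancellation g h e := by
    ext x
    exact hf (congrFun (congrArg Hom.toFun e) x)

/-- The image of an `M`-equivariant map. -/
def image {M : ProfMon.{u}} {X Y : FinMSet M} (f : X ⟶ Y) : FinMSet M :=
  ofHom (FintypeCat.of (Set.range f.toFun))
    (fun m => FintypeCat.homMk fun y => ⟨Y.act y.1 m, by
      obtain ⟨_, x, rfl⟩ := y
      exact ⟨X.act x m, f.map_act x m⟩⟩)
    (FintypeCat.hom_ext _ _ fun y => Subtype.ext (Y.act_one y.1))
    (fun m n => FintypeCat.hom_ext _ _ fun y => Subtype.ext (Y.act_mul y.1 m n).symm)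
    (fun m₀ => by
      filter_upwards [actHom_eventually Y m₀] with m hm
      refine FintypeCat.hom_ext _ _ fun y => ?_
      have h : Y.act y.1 m = Y.act y.1 m₀ := ConcreteCategory.congr_hom hm (y.1 : Y.carrier)
      exact Subtype.ext h)

/-- The one-point `M`-set. -/
def point (M : ProfMon.{u}) : FinMSet M :=
  ofHom (FintypeCat.of PUnit) (fun _ => 𝟙 _) rfl (fun _ _ => (Category.comp_id _).symm)
    (fun _ => Filter.Eventually.of_forall fun _ => rfl)

/-- The empty `M`-set. -/
def empty (M : ProfMon.{u}) : FinMSet M :=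
  ofHom (FintypeCat.of PEmpty) (fun _ => 𝟙 _) rfl (fun _ _ => (Category.comp_id _).symm)
    (fun _ => Filter.Eventually.of_forall fun _ => rfl)

/-- The one-point `M`-set is terminal. -/
def pointIsTerminal (M : ProfMon.{u}) : IsTerminal (point M) :=
  IsTerminal.ofUniqueHom (fun _ => ⟨fun _ => PUnit.unit, fun _ _ => rfl⟩)
    (fun _ _ => by ext x; rfl)

lemma isSemiGalois (M : ProfMon.{u}) : IsSemiGalois (fiber M) where
  hasInitial := inferInstance
  hasTerminal := inferInstance
  hasPullbacks := inferInstance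
  hasPushouts := inferInstance
  factorization {X Y} f := by
    refine ⟨image f, ⟨fun x => ⟨f.toFun x, x, rfl⟩, fun x m => Subtype.ext (f.map_act x m)⟩,
      ⟨fun y => y.1, fun _ _ => rfl⟩, epi_of_surjective _ ?_, mono_of_injective _ ?_, rfl⟩
    · rintro ⟨_, x, rfl⟩
      exact ⟨x, rfl⟩
    · exact fun _ _ h => Subtype.ext h
  obj_initial := ⟨fun x => PEmpty.elim (((initial.to (empty M) : _ ⟶ _).toFun x : PEmpty))⟩
  obj_terminal := by
    have e : (fiber M).obj (⊤_ (FinMSet M)) ≅ FintypeCat.of PUnit :=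
      (fiber M).mapIso (terminalIsTerminal.uniqueUpToIso (pointIsTerminal M))
    exact ⟨(FintypeCat.equivEquivIso.symm e).unique⟩
  preservesPullbacks := inferInstance
  preservesPushouts := inferInstance
  reflectsIsomorphisms := inferInstance

/-- The finite `M`-sets with underlying set `Fin n`. -/
def Small (M : ProfMon.{u}) : Type u :=
  Σ n : ℕ, { X : Fin n → M → Fin n // (∀ x m n, X (X x m) n = X x (m * n)) ∧ (∀ x, X x 1 = x) ∧
    Continuous fun p : Fin n × M => X p.1 p.2 }

/-- The finite `M`-set given by an action on `Fin n`. -/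
def ofSmall {M : ProfMon.{u}} (s : Small M) : FinMSet M :=
  ofHom (FintypeCat.of (ULift.{u} (Fin s.1)))
    (fun m => FintypeCat.homMk fun x => ⟨s.2.1 x.down m⟩)
    (FintypeCat.hom_ext _ _ fun x => ULift.ext _ _ (s.2.2.2.1 x.down))
    (fun m n => FintypeCat.hom_ext _ _ fun x => ULift.ext _ _ (s.2.2.1 x.down m n).symm)
    (fun m₀ => by
      have h : ∀ x : Fin s.1, ∀ᶠ m in 𝓝 m₀, s.2.1 x m = s.2.1 x m₀ := fun x =>
        ((s.2.2.2.2.comp (by fun_prop : Continuous fun m : M => (x, m))).tendsto m₀).eventually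
          (p := fun y => y = s.2.1 x m₀) (by rw [nhds_discrete]; exact rfl)
      filter_upwards [Filter.eventually_all.2 h] with m hm
      exact FintypeCat.hom_ext _ _ fun x => ULift.ext _ _ (hm x.down))

lemma exists_ofSmall {M : ProfMon.{u}} (X : FinMSet M) : ∃ s : Small M, Nonempty (ofSmall s ≅ X) := by
  obtain ⟨n, ⟨e⟩⟩ := Finite.exists_equiv_fin X.carrier
  refine ⟨⟨n, fun x m => e (X.act (e.symm x) m), ?_, ?_, ?_⟩,
    ⟨⟨⟨fun x => e.symm x.down, ?_⟩, ⟨fun x => ⟨e x⟩, ?_⟩, ?_, ?_⟩⟩⟩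
  · intro x m n
    simp [X.act_mul]
  · intro x
    simp [X.act_one]
  · let _ : TopologicalSpace X.carrier := ⊥
    have : DiscreteTopology X.carrier := ⟨rfl⟩
    exact (continuous_of_discreteTopology (f := e)).comp (X.continuous_act.comp
      (((continuous_of_discreteTopology (f := e.symm)).comp continuous_fst).prodMk continuous_snd))
  · exact fun x m => e.symm_apply_apply _
  · intro x m
    exact ULift.ext _ _ (congrArg (fun y => e (X.act y m)) (e.symm_apply_apply x).symm)
  · ext x
    exact ULift.ext _ _ (e.apply_symm_apply x.down)
  · ext x
    exact e.symm_apply_apply x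

instance (M : ProfMon.{u}) : EssentiallySmall.{u} (FinMSet M) := by
  rw [essentiallySmall_iff]
  refine ⟨?_, inferInstance⟩
  refine small_of_surjective (f := fun s : Small M => toSkeleton (ofSmall s)) fun q => ?_
  obtain ⟨s, ⟨i⟩⟩ := exists_ofSmall ((fromSkeleton _).obj q)
  refine ⟨s, ?_⟩
  have h : toSkeleton (ofSmall s) = toSkeleton ((fromSkeleton _).obj q) :=
    Quotient.sound ⟨i⟩
  exact h.trans (Quotient.out_eq q)

/-- Restriction of actions along a continuous homomorphism. -/
def restrict {M N : ProfMon.{u}} (f : M →ₜ* N) : FinMSet N ⥤ FinMSet M where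
  obj X :=
    { carrier := X.carrier
      act := fun x m => X.act x (f m)
      act_mul := fun x m n => by rw [X.act_mul, map_mul]
      act_one := fun x => by rw [map_one, X.act_one]
      continuous_act := by
        let _ : TopologicalSpace X.carrier := ⊥
        exact X.continuous_act.comp
          (continuous_fst.prodMk (f.continuous_toFun.comp continuous_snd)) }
  map g := ⟨g.toFun, fun x m => g.map_act x (f m)⟩

/-- Restriction of actions does not change underlying sets. -/
def restrictIso {M N : ProfMon.{u}} (f : M →ₜ* N) : restrict f ⋙ fiber M ≅ fiber N := Iso.refl _

instance {M N : ProfMon.{u}} (f : M →ₜ* N) : PreservesFiniteLimits (restrict f) where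
  preservesFiniteLimits J _ _ := by
    have : PreservesLimitsOfShape J (restrict f ⋙ fiber M) :=
      inferInstanceAs (PreservesLimitsOfShape J (fiber N))
    have : ReflectsLimitsOfShape J (fiber M) := reflectsLimitsOfShape_of_reflectsIsomorphisms
    exact preservesLimitsOfShape_of_reflects_of_preserves (restrict f) (fiber M)

instance {M N : ProfMon.{u}} (f : M →ₜ* N) : PreservesFiniteColimits (restrict f) where
  preservesFiniteColimits J _ _ := by
    have : PreservesColimitsOfShape J (restrict f ⋙ fiber M) :=
      inferInstanceAs (PreservesColimitsOfShape J (fiber N))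
    have : ReflectsColimitsOfShape J (fiber M) := reflectsColimitsOfShape_of_reflectsIsomorphisms
    exact preservesColimitsOfShape_of_reflects_of_preserves (restrict f) (fiber M)

/-- The semi-galois category of finite `M`-sets. -/
def semiGal (M : ProfMon.{u}) : SemiGal.{u} where
  C := FinMSet M
  F := fiber M
  isSemiGalois := isSemiGalois M

/-- Restriction of actions as an exact functor. -/
def restrictExact {M N : ProfMon.{u}} (f : M →ₜ* N) : SemiGalExactFunctor (semiGal N) (semiGal M) where
  A := restrict f
  preservesFiniteLimits := inferInstanceAs (PreservesFiniteLimits (restrict f))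
  preservesFiniteColimits := inferInstanceAs (PreservesFiniteColimits (restrict f))
  σ := restrictIso f

end FinMSet

/-- The functor `M ↦ ⟨B_f M, F_M⟩`, `f ↦ [restriction along f, id]`. -/
def finMSetFunctor : ProfMon.{u} ⥤ SemiGal.{u}ᵒᵖ where
  obj M := Opposite.op (FinMSet.semiGal M)
  map f := Quiver.Hom.op (Quotient.mk _ (FinMSet.restrictExact f))
  map_id _ := congrArg Quiver.Hom.op (Quotient.sound ⟨Iso.refl _, rfl⟩)
  map_comp _ _ := congrArg Quiver.Hom.op (Quotient.sound ⟨Iso.refl _, rfl⟩)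

/-! ### The fundamental monoid -/

/-- The natural endomorphisms of `F`. -/
def FiberEnd {C : Type*} [Category* C] (F : C ⥤ FintypeCat.{u}) := F ⟶ F

namespace FiberEnd

variable {C : Type*} [Category* C] (F : C ⥤ FintypeCat.{u})

/-- Natural endomorphisms act from the right: `φ * ψ` is first `φ`, then `ψ`. -/
instance : Monoid (FiberEnd F) where
  mul := fun (φ ψ : F ⟶ F) => φ ≫ ψ
  one := 𝟙 F
  mul_assoc := fun (φ ψ χ : F ⟶ F) => Category.assoc φ ψ χ
  one_mul := fun φ : F ⟶ F => Category.id_comp φ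
  mul_one := fun φ : F ⟶ F => Category.comp_id φ

/-- The action of `φ` on an element of a fiber. -/
def eval {F : C ⥤ FintypeCat.{u}} (φ : FiberEnd F) (X : C) (x : F.obj X) : F.obj X :=
  NatTrans.app φ X x

/-- The fibers carry the discrete topology. -/
@[reducible]
def fiberTopology (X : C) : TopologicalSpace (F.obj X) := ⊥

lemma fiber_discrete (X : C) : @DiscreteTopology (F.obj X) (fiberTopology F X) :=
  @DiscreteTopology.mk _ (fiberTopology F X) rfl

/-- The topology of pointwise convergence on the (discrete) fibers. -/
instance : TopologicalSpace (FiberEnd F) :=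
  TopologicalSpace.induced (fun φ => φ.eval)
    (@Pi.topologicalSpace C _ fun X => @Pi.topologicalSpace _ _ fun _ => fiberTopology F X)

lemma eval_injective : Function.Injective fun φ : FiberEnd F => φ.eval := by
  intro φ ψ h
  refine NatTrans.ext (funext fun X => FintypeCat.hom_ext _ _ fun x => ?_)
  exact congrFun (congrFun h X) x

lemma eval_naturality {F : C ⥤ FintypeCat.{u}} (φ : FiberEnd F) {X Y : C} (f : X ⟶ Y)
    (x : F.obj X) : F.map f (φ.eval X x) = φ.eval Y (F.map f x) :=
  (ConcreteCategory.congr_hom (NatTrans.naturality φ f) x).symm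

section

attribute [local instance] fiberTopology fiber_discrete

lemma continuous_eval (X : C) (x : F.obj X) : Continuous fun φ : FiberEnd F => φ.eval X x := by
  have h : Continuous fun φ : FiberEnd F => φ.eval := continuous_induced_dom
  exact (continuous_apply x).comp ((continuous_apply X).comp h)

lemma continuous_iff {T : Type*} [TopologicalSpace T] (g : T → FiberEnd F) :
    Continuous g ↔ ∀ (X : C) (x : F.obj X), Continuous fun t => (g t).eval X x := by
  rw [continuous_induced_rng, continuous_pi_iff]
  exact forall_congr' fun X => continuous_pi_iff

lemma isClosedEmbedding_eval : IsClosedEmbedding fun φ : FiberEnd F => φ.eval where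
  eq_induced := rfl
  injective := eval_injective F
  isClosed_range := by
    have h : (Set.range fun φ : FiberEnd F => φ.eval) =
        ⋂ (X : C) (Y : C) (f : X ⟶ Y) (x : F.obj X),
          {a : ∀ X, F.obj X → F.obj X | F.map f (a X x) = a Y (F.map f x)} := by
      ext a
      simp only [Set.mem_range, Set.mem_iInter, Set.mem_ofPred_eq]
      constructor
      · rintro ⟨φ, rfl⟩ X Y f x
        exact φ.eval_naturality f x
      · intro h
        exact ⟨{ app := fun X => FintypeCat.homMk (a X)
                 naturality := fun X Y f =>
                  FintypeCat.hom_ext _ _ fun x => (h X Y f x).symm }, rfl⟩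
    rw [h]
    refine isClosed_iInter fun X => isClosed_iInter fun Y => isClosed_iInter fun f =>
      isClosed_iInter fun x => isClosed_eq ?_ ?_
    · exact (continuous_of_discreteTopology (f := F.map f)).comp
        ((continuous_apply x).comp (continuous_apply X))
    · exact (continuous_apply _).comp (continuous_apply Y)

instance : CompactSpace (FiberEnd F) := (isClosedEmbedding_eval F).compactSpace

instance : T2Space (FiberEnd F) := (isClosedEmbedding_eval F).isEmbedding.t2Space

instance : TotallyDisconnectedSpace (FiberEnd F) :=
  (isClosedEmbedding_eval F).isEmbedding.isTotallyDisconnected_range.mp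
    (isTotallyDisconnected_of_totallyDisconnectedSpace _)

instance : ContinuousMul (FiberEnd F) where
  continuous_mul := by
    rw [continuous_iff]
    intro X x
    have h : Continuous fun q : (F.obj X → F.obj X) × (F.obj X → F.obj X) => q.2 (q.1 x) := by
      refine continuous_of_discreteTopology
    exact h.comp (Continuous.prodMk
      ((continuous_pi fun y => continuous_eval F X y).comp continuous_fst)
      ((continuous_pi fun y => continuous_eval F X y).comp continuous_snd))

end

instance [EssentiallySmall.{u} C] : _root_.Small.{u} (FiberEnd F) := by
  let e := equivSmallModel.{u} C
  refine small_of_injective (β := ∀ s : SmallModel.{u} C, F.obj (e.inverse.obj s) →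
    F.obj (e.inverse.obj s)) (f := fun φ s => φ.eval (e.inverse.obj s)) ?_
  intro φ ψ h
  refine eval_injective F (funext fun X => funext fun x => ?_)
  let i := e.unitIso.app X
  have hi : F.map i.inv (F.map i.hom x) = x :=
    ConcreteCategory.congr_hom (F.mapIso i).hom_inv_id x
  have h' := congrArg (F.map i.inv) (congrFun (congrFun h (e.functor.obj X)) (F.map i.hom x))
  have hφ := φ.eval_naturality i.inv (F.map i.hom x)
  have hψ := ψ.eval_naturality i.inv (F.map i.hom x)
  rw [hi] at hφ hψ
  exact hφ.symm.trans (h'.trans hψ)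

end FiberEnd

/-- The fundamental monoid of a semi-galois category: the monoid of natural endomorphisms of its
fiber functor, brought to `Type u`. -/
noncomputable def fundMonoid (X : SemiGal.{u}) : ProfMon.{u} where
  carrier := Shrink.{u} (FiberEnd X.F)
  continuousMul := ⟨by
    have h : Continuous fun p : Shrink.{u} (FiberEnd X.F) × Shrink.{u} (FiberEnd X.F) =>
        (Shrink.homeomorph _).symm p.1 * (Shrink.homeomorph _).symm p.2 := by fun_prop
    exact (Shrink.homeomorph _).continuous.comp h⟩
  compact := (Shrink.homeomorph _).compactSpace
  hausdorff := (Shrink.homeomorph _).t2Space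
  totallyDisconnected := (Shrink.homeomorph _).totallyDisconnectedSpace

/-- The canonical identification of the fundamental monoid with `End(F)`. -/
noncomputable def fundMonoidEquiv (X : SemiGal.{u}) : fundMonoid X ≃ₜ* FiberEnd X.F where
  toEquiv := (equivShrink _).symm
  map_mul' := equivShrink_symm_mul
  continuous_toFun := (Shrink.homeomorph _).symm.continuous
  continuous_invFun := (Shrink.homeomorph _).continuous

namespace SemiGalExactFunctor

/-- The map `φ ↦ σ⁻¹ · (φ A) · σ`. -/
def endMap {X Y : SemiGal.{u}} (f : SemiGalExactFunctor X Y) : FiberEnd Y.F →ₜ* FiberEnd X.F where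
  toFun φ := f.σ.inv ≫ Functor.whiskerLeft f.A φ ≫ f.σ.hom
  map_one' := by
    refine NatTrans.ext (funext fun x => ?_)
    have h : f.σ.inv.app x ≫ 𝟙 _ ≫ f.σ.hom.app x = 𝟙 _ := by simp
    exact h
  map_mul' φ ψ := by
    refine NatTrans.ext (funext fun x => ?_)
    have h : ∀ a b : Y.F.obj (f.A.obj x) ⟶ Y.F.obj (f.A.obj x),
        f.σ.inv.app x ≫ (a ≫ b) ≫ f.σ.hom.app x =
        (f.σ.inv.app x ≫ a ≫ f.σ.hom.app x) ≫ (f.σ.inv.app x ≫ b ≫ f.σ.hom.app x) := by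
      intro a b
      simp
    exact h _ _
  continuous_toFun := by
    refine (FiberEnd.continuous_iff _ _).2 fun x ξ => ?_
    let _ := FiberEnd.fiberTopology X.F x
    let _ : TopologicalSpace ((f.A ⋙ Y.F).obj x) := FiberEnd.fiberTopology Y.F (f.A.obj x)
    have : DiscreteTopology ((f.A ⋙ Y.F).obj x) := FiberEnd.fiber_discrete Y.F (f.A.obj x)
    exact (continuous_of_discreteTopology (f := f.σ.hom.app x)).comp
      (FiberEnd.continuous_eval Y.F (f.A.obj x) (f.σ.inv.app x ξ))

/-- The map of fundamental monoids induced by an exact functor. -/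
noncomputable def fundMonoidMap {X Y : SemiGal.{u}} (f : SemiGalExactFunctor X Y) :
    fundMonoid Y ⟶ fundMonoid X :=
  ((fundMonoidEquiv X).symm : FiberEnd X.F →ₜ* fundMonoid X).comp
    (f.endMap.comp (fundMonoidEquiv Y : fundMonoid Y →ₜ* FiberEnd Y.F))

lemma endMap_congr {X Y : SemiGal.{u}} (f g : SemiGalExactFunctor X Y) (h : f ≈ g) :
    f.endMap = g.endMap := by
  obtain ⟨l, hl⟩ := h
  ext φ
  refine NatTrans.ext (funext fun x => ?_)
  have h1 : Y.F.map (l.hom.app x) ≫ g.σ.hom.app x = f.σ.hom.app x := NatTrans.congr_app hl x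
  have h2 := NatTrans.naturality φ (l.hom.app x)
  have h : ∀ (a : Y.F.obj (f.A.obj x) ⟶ _) (b : Y.F.obj (g.A.obj x) ⟶ _),
      Y.F.map (l.hom.app x) ≫ b = a ≫ Y.F.map (l.hom.app x) →
      f.σ.inv.app x ≫ a ≫ f.σ.hom.app x = g.σ.inv.app x ≫ b ≫ g.σ.hom.app x := by
    intro a b hab
    rw [← h1, ← reassoc_of% hab, ← Category.assoc]
    congr 1
    rw [← cancel_epi (f.σ.hom.app x), Iso.hom_inv_id_app_assoc, ← h1, Category.assoc,
      Iso.hom_inv_id_app]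
    exact (Category.comp_id _).symm
  exact h _ _ h2

lemma fundMonoidMap_congr {X Y : SemiGal.{u}} (f g : SemiGalExactFunctor X Y) (h : f ≈ g) :
    f.fundMonoidMap = g.fundMonoidMap := by
  rw [fundMonoidMap, endMap_congr f g h, fundMonoidMap]

end SemiGalExactFunctor

/-- The functor `⟨C, F⟩ ↦ π₁(C, F)`, `[A, σ] ↦ (φ ↦ σ⁻¹ · (φ A) · σ)`. -/
noncomputable def fundMonoidFunctor : SemiGal.{u}ᵒᵖ ⥤ ProfMon.{u} where
  obj X := fundMonoid X.unop
  map f := Quotient.lift SemiGalExactFunctor.fundMonoidMap SemiGalExactFunctor.fundMonoidMap_congr f.unop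
  map_id X := by
    refine ContinuousMonoidHom.ext fun φ => ?_
    have h : (SemiGalExactFunctor.id X.unop).endMap (fundMonoidEquiv X.unop φ) =
        fundMonoidEquiv X.unop φ := rfl
    exact (congrArg (fundMonoidEquiv X.unop).symm h).trans
      ((fundMonoidEquiv X.unop).symm_apply_apply φ)
  map_comp := by
    rintro X Y Z ⟨⟨f⟩⟩ ⟨⟨g⟩⟩
    refine ContinuousMonoidHom.ext fun φ => ?_
    have h : (g.comp f).endMap (fundMonoidEquiv X.unop φ) =
        g.endMap (f.endMap (fundMonoidEquiv X.unop φ)) := rfl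
    refine (congrArg (fundMonoidEquiv Z.unop).symm h).trans ?_
    refine congrArg (fun ψ => (fundMonoidEquiv Z.unop).symm (g.endMap ψ)) ?_
    exact ((fundMonoidEquiv Y.unop).apply_symm_apply _).symm

/-! ### Galois objects -/

/-- A galois object: a pair `(X, ξ)` such that `X` is the minimal subobject of `X` whose fiber
contains `ξ`, and `f ↦ F(f)(ξ)` is a bijection from `End(X)` to `F(X)`. -/
structure GaloisObject {C : Type*} [Category* C] (F : C ⥤ FintypeCat.{u}) where
  X : C
  ξ : F.obj X
  minimal : ∀ (Z : C) (j : Z ⟶ X), Mono j → ξ ∈ Set.range (F.map j) → IsIso j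
  bijective : Function.Bijective fun f : End X => (F.map f ξ : F.obj X)

/-- The inverse limit of the finite monoids `End(X)` over the galois objects `(X, ξ)`: an arrow
`l : (X, ξ) → (X', ξ')` of galois objects sends `u : End(X)` to the `u' : End(X')` with
`u' ∘ l = l ∘ u`. Multiplication is composition, `u * v = u ∘ v`. -/
def galoisLimit {C : Type*} [Category* C] (F : C ⥤ FintypeCat.{u}) :
    Submonoid (∀ Γ : GaloisObject F, End Γ.X) where
  carrier := {u | ∀ (Γ Γ' : GaloisObject F) (l : Γ.X ⟶ Γ'.X), F.map l Γ.ξ = Γ'.ξ →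
    u Γ ≫ l = l ≫ u Γ'}
  one_mem' Γ Γ' l _ := (Category.id_comp l).trans (Category.comp_id l).symm
  mul_mem' {u v} hu hv Γ Γ' l h := by
    change (v Γ ≫ u Γ) ≫ l = l ≫ v Γ' ≫ u Γ'
    rw [Category.assoc, hu Γ Γ' l h, ← Category.assoc, hv Γ Γ' l h, Category.assoc]

/-- The inverse limit topology, the monoids `End(X)` being discrete. -/
instance {C : Type*} [Category* C] (F : C ⥤ FintypeCat.{u}) :
    TopologicalSpace (galoisLimit F) :=
  TopologicalSpace.induced Subtype.val
    (@Pi.topologicalSpace (GaloisObject F) (fun Γ => End Γ.X) fun _ => ⊥)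

/-! ### Galois categories -/

/-- `⟨C, F⟩` is a galois category, i.e. `C` satisfies the axioms of a galois category with the fiber
functor `F`. -/
def IsGaloisWithFiber {C : Type*} [Category* C] (F : C ⥤ FintypeCat.{u}) : Prop :=
  ∃ _ : PreGaloisCategory C, PreGaloisCategory.FiberFunctor F

/-! ### Exact fiber functors -/

namespace IsSemiGalois

variable {C : Type*} [Category* C] {F : C ⥤ FintypeCat.{u}}

/-! Everything rests on pointed objects $(X,\xi)$, $\xi\in F(X)$, that are minimal: no proper
subobject contains $\xi$. Fibers are finite, so every point lies in a minimal subobject, and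
equalizers show that an arrow out of a minimal object is determined by the image of $\xi$. The
exactness of $F$ and compactness of $\prod_X F(X)^{F(X)}$ then show that $\mathrm{End}(F)$ carries
$\xi$ to every point of $F(X)$ (`IsMinimal.exists_eval_eq`). Hence the $\mathrm{End}(F)$-stable
subsets of a fiber are exactly the fibers of subobjects (`exists_mono_range_eq`).

This makes $\mathscr C\to\mathscr B_f\,\mathrm{End}(F)$ an equivalence. It is full because the graph
of an equivariant map is a stable subset. It is essentially surjective because a finite
$\mathrm{End}(F)$-set is a quotient of a coproduct of copies of one minimal object, and the kernel
of the quotient map is again a stable subset. Conversely, $M\to\mathrm{End}(\mathrm F_M)$ is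
bijective: open right congruences separate the points of $M$, and a natural endomorphism is given on
finitely many points at once by an element of $M$, hence by compactness on all points. Both
identifications are natural, which gives the duality.

For the limit formula, every point of every fiber is the image of the distinguished point of a
galois object, found inside the power $X^{F(X)}$ (`exists_galoisObject`). So a natural endomorphism
amounts to a compatible family of endomorphisms of galois objects.

For galois categories: if $\mathrm{End}(F)$ is a group, complements of stable subsets are stable, so
subobjects have complements. Conversely, natural endomorphisms of a galois fiber functor are
invertible, and classical galois theory identifies $\mathscr C$ with $\mathscr
B_f\,\mathrm{End}(F)$, from which the semi-galois axioms are transported. -/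

lemma hasFiniteLimits (hF : IsSemiGalois F) : HasFiniteLimits C := by
  have := hF.hasTerminal
  have := hF.hasPullbacks
  exact hasFiniteLimits_of_hasTerminal_and_pullbacks

lemma hasFiniteColimits (hF : IsSemiGalois F) : HasFiniteColimits C := by
  have := hF.hasInitial
  have := hF.hasPushouts
  exact hasFiniteColimits_of_hasInitial_and_pushouts

/-- A singleton is terminal among finite sets, and a terminal object together with pullbacks
generates all finite limits. -/
lemma preservesFiniteLimits (hF : IsSemiGalois F) : PreservesFiniteLimits F := by
  have := hF.hasTerminal
  have := hF.hasPullbacks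
  have := hF.preservesPullbacks
  obtain ⟨_⟩ := hF.obj_terminal
  have ht : IsTerminal (F.obj (⊤_ C)) :=
    IsTerminal.ofUniqueHom (fun _ => FintypeCat.homMk fun _ => default)
      (fun _ _ => FintypeCat.hom_ext _ _ fun _ => Subsingleton.elim _ _)
  have := preservesTerminal_of_iso F (ht.uniqueUpToIso terminalIsTerminal)
  have := preservesLimitsOfShape_pempty_of_preservesTerminal F
  exact preservesFiniteLimits_of_preservesTerminal_and_pullbacks F

lemma preservesFiniteColimits (hF : IsSemiGalois F) : PreservesFiniteColimits F := by
  have := hF.hasInitial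
  have := hF.hasPushouts
  have := hF.preservesPushouts
  have := hF.obj_initial
  have hi : IsInitial (F.obj (⊥_ C)) :=
    IsInitial.ofUniqueHom (fun _ => FintypeCat.homMk fun x => isEmptyElim x)
      (fun _ _ => FintypeCat.hom_ext _ _ fun x => isEmptyElim x)
  have := preservesInitial_of_iso F (initialIsInitial.uniqueUpToIso hi)
  have := preservesColimitsOfShape_pempty_of_preservesInitial F
  exact preservesFiniteColimits_of_preservesInitial_and_pushouts F

end IsSemiGalois

namespace FiberFunctor

variable {C : Type*} [Category* C] {F : C ⥤ FintypeCat.{u}}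

/-! ### Points of the fibers of limits and colimits -/

section limits

lemma isIso_of_bijective [F.ReflectsIsomorphisms] {X Y : C} (f : X ⟶ Y)
    (hf : Function.Bijective (F.map f)) : IsIso f := by
  have : IsIso (F.map f) := (ConcreteCategory.isIso_iff_bijective (F.map f)).mpr hf
  exact isIso_of_reflects_iso f F

variable [PreservesFiniteLimits F]

lemma map_injective_of_mono {X Y : C} (f : X ⟶ Y) [Mono f] : Function.Injective (F.map f) :=
  ConcreteCategory.injective_of_mono_of_preservesPullback (F.map f)

variable [HasFiniteLimits C]

lemma exists_equalizer_point {X Y : C} (f g : X ⟶ Y) (x : F.obj X) (h : F.map f x = F.map g x) :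
    x ∈ Set.range (F.map (equalizer.ι f g)) := by
  let hl := isLimitForkMapOfIsLimit F (equalizer.condition f g) (equalizerIsEqualizer f g)
  -- A point of a fiber is an arrow from the one-point set, so the universal property of the image
  -- cone produces points.
  let k : FintypeCat.of PUnit.{u + 1} ⟶ F.obj X := FintypeCat.homMk fun _ => x
  have hk : k ≫ F.map f = k ≫ F.map g := FintypeCat.hom_ext _ _ fun _ => h
  refine ⟨hl.lift (Fork.ofι k hk) PUnit.unit, ?_⟩
  exact ConcreteCategory.congr_hom (hl.fac (Fork.ofι k hk) WalkingParallelPair.zero) PUnit.unit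

lemma exists_pullback_point {X Y S : C} (f : X ⟶ S) (g : Y ⟶ S) (x : F.obj X) (y : F.obj Y)
    (h : F.map f x = F.map g y) :
    ∃ z : F.obj (pullback f g), F.map (pullback.fst f g) z = x ∧ F.map (pullback.snd f g) z = y := by
  let hl := isLimitPullbackConeMapOfIsLimit F pullback.condition (pullbackIsPullback f g)
  let k : FintypeCat.of PUnit.{u + 1} ⟶ F.obj X := FintypeCat.homMk fun _ => x
  let l : FintypeCat.of PUnit.{u + 1} ⟶ F.obj Y := FintypeCat.homMk fun _ => y
  have hk : k ≫ F.map f = l ≫ F.map g := FintypeCat.hom_ext _ _ fun _ => h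
  exact ⟨hl.lift (PullbackCone.mk k l hk) PUnit.unit,
    ConcreteCategory.congr_hom (hl.fac (PullbackCone.mk k l hk) WalkingCospan.left) PUnit.unit,
    ConcreteCategory.congr_hom (hl.fac (PullbackCone.mk k l hk) WalkingCospan.right) PUnit.unit⟩

/-- If `F` identifies two arrows, their equalizer is bijective on fibers, hence an isomorphism. -/
lemma faithful [F.ReflectsIsomorphisms] : F.Faithful where
  map_injective {X Y} f g h := by
    have : IsIso (equalizer.ι f g) := isIso_of_bijective (F := F) _ ⟨map_injective_of_mono _,
      fun x => exists_equalizer_point f g x (by rw [h])⟩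
    exact eq_of_epi_equalizer

lemma mono_of_injective [F.ReflectsIsomorphisms] {X Y : C} (f : X ⟶ Y)
    (hf : Function.Injective (F.map f)) : Mono f := by
  have := faithful (F := F)
  have : Mono (F.map f) := ConcreteCategory.mono_of_injective _ hf
  exact F.mono_of_mono_map this

lemma exists_pi_point {ι : Type*} [Finite ι] (X : ι → C) (x : ∀ i, F.obj (X i)) :
    ∃ z : F.obj (∏ᶜ X), ∀ i, F.map (Pi.π X i) z = x i := by
  let e : F.obj (∏ᶜ X) ≅ ∏ᶜ fun i => F.obj (X i) := PreservesProduct.iso F X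
  refine ⟨e.inv ((FintypeCat.productEquiv fun i => F.obj (X i)).symm x), fun i => ?_⟩
  have h1 : e.inv ≫ F.map (Pi.π X i) = Pi.π (fun i => F.obj (X i)) i := by
    rw [Iso.inv_comp_eq]
    simp [e]
  exact (ConcreteCategory.congr_hom h1 _).trans
    (FintypeCat.productEquiv_symm_comp_π_apply (fun i => F.obj (X i)) x i)

lemma pi_point_ext {ι : Type*} [Finite ι] (X : ι → C) (z z' : F.obj (∏ᶜ X))
    (h : ∀ i, F.map (Pi.π X i) z = F.map (Pi.π X i) z') : z = z' := by
  let e : F.obj (∏ᶜ X) ≅ ∏ᶜ fun i => F.obj (X i) := PreservesProduct.iso F X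
  have h1 : ∀ i, e.hom ≫ Pi.π (fun i => F.obj (X i)) i = F.map (Pi.π X i) := fun i => by
    simp [e]
  refine (FintypeCat.equivEquivIso.symm e).injective
    ((FintypeCat.productEquiv fun i => F.obj (X i)).injective (funext fun i => ?_))
  rw [FintypeCat.productEquiv_apply, FintypeCat.productEquiv_apply]
  have h2 := ConcreteCategory.congr_hom (h1 i) z
  have h3 := ConcreteCategory.congr_hom (h1 i) z'
  exact h2.trans ((h i).trans h3.symm)

lemma exists_prod_point (X Y : C) (x : F.obj X) (y : F.obj Y) :
    ∃ z : F.obj (X ⨯ Y), F.map prod.fst z = x ∧ F.map prod.snd z = y := by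
  let e := PreservesLimitPair.iso F X Y
  let k : FintypeCat.of PUnit.{u + 1} ⟶ F.obj X := FintypeCat.homMk fun _ => x
  let l : FintypeCat.of PUnit.{u + 1} ⟶ F.obj Y := FintypeCat.homMk fun _ => y
  have h1 : (prod.lift k l ≫ e.inv) ≫ F.map prod.fst = k := by
    simpa [e] using prod.lift_fst k l
  have h2 : (prod.lift k l ≫ e.inv) ≫ F.map prod.snd = l := by
    simpa [e] using prod.lift_snd k l
  exact ⟨(prod.lift k l ≫ e.inv) PUnit.unit, ConcreteCategory.congr_hom h1 PUnit.unit,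
    ConcreteCategory.congr_hom h2 PUnit.unit⟩

lemma prod_point_ext (X Y : C) (z z' : F.obj (X ⨯ Y))
    (h1 : F.map prod.fst z = F.map prod.fst z') (h2 : F.map prod.snd z = F.map prod.snd z') :
    z = z' := by
  let e := PreservesLimitPair.iso F X Y
  let k (z : F.obj (X ⨯ Y)) : FintypeCat.of PUnit.{u + 1} ⟶ F.obj (X ⨯ Y) :=
    FintypeCat.homMk fun _ => z
  have h : k z = k z' := by
    rw [← cancel_mono e.hom]
    apply Limits.prod.hom_ext
    · have : e.hom ≫ prod.fst = F.map prod.fst := by simp [e]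
      rw [Category.assoc, Category.assoc, this]
      exact FintypeCat.hom_ext _ _ fun _ => h1
    · have : e.hom ≫ prod.snd = F.map prod.snd := by simp [e]
      rw [Category.assoc, Category.assoc, this]
      exact FintypeCat.hom_ext _ _ fun _ => h2
  exact ConcreteCategory.congr_hom h PUnit.unit

end limits

lemma map_surjective_of_epi [PreservesFiniteColimits F] {X Y : C} (f : X ⟶ Y) [Epi f] :
    Function.Surjective (F.map f) :=
  ConcreteCategory.surjective_of_epi_of_preservesPushout (F.map f)

lemma exists_sigma_point [PreservesFiniteColimits F] [HasFiniteColimits C] {ι : Type*} [Finite ι]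
    (X : ι → C) (z : F.obj (∐ X)) : ∃ (i : ι) (x : F.obj (X i)), F.map (Sigma.ι X i) x = z := by
  obtain ⟨⟨i⟩, x, hx⟩ := Concrete.isColimit_exists_rep (Discrete.functor X ⋙ F)
    (isColimitOfPreserves F (coproductIsCoproduct X)) z
  exact ⟨i, x, hx⟩

/-! ### Pointed objects -/

variable (F) in
/-- `X` is its only subobject whose fiber contains `ξ`. -/
def IsMinimal (X : C) (ξ : F.obj X) : Prop :=
  ∀ (Z : C) (j : Z ⟶ X), Mono j → ξ ∈ Set.range (F.map j) → IsIso j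

section

variable [PreservesFiniteLimits F]

/-- The equalizer of `f` and `g` is a subobject through `ξ`, so it is all of `X`. -/
lemma IsMinimal.hom_ext [HasFiniteLimits C] {X Y : C} {ξ : F.obj X} (h : IsMinimal F X ξ) {f g : X ⟶ Y}
    (hfg : F.map f ξ = F.map g ξ) : f = g := by
  have : IsIso (equalizer.ι f g) := h _ _ inferInstance (exists_equalizer_point f g ξ hfg)
  exact eq_of_epi_equalizer

/-- Descent on the size of the fiber: a proper subobject has a strictly smaller one, because `F`
reflects isomorphisms. -/
lemma exists_isMinimal [F.ReflectsIsomorphisms] (X : C) (ξ : F.obj X) :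
    ∃ (Z : C) (ζ : F.obj Z) (j : Z ⟶ X), Mono j ∧ F.map j ζ = ξ ∧ IsMinimal F Z ζ := by
  induction hn : Nat.card (F.obj X) using Nat.strong_induction_on generalizing X with
  | _ n ih =>
    by_cases h : IsMinimal F X ξ
    · exact ⟨X, ξ, 𝟙 X, inferInstance, by simp, h⟩
    · simp only [IsMinimal, not_forall] at h
      obtain ⟨W, i, hi, ⟨ω, hω⟩, hni⟩ := h
      have hinj := map_injective_of_mono (F := F) i
      have hlt : Nat.card (F.obj W) < n := by
        refine hn ▸ lt_of_le_of_ne (Nat.card_le_card_of_injective _ hinj) fun he => hni ?_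
        exact isIso_of_bijective i (hinj.bijective_of_nat_card_le he.ge)
      obtain ⟨Z, ζ, j, hj, hζ, hm⟩ := ih _ hlt W ω rfl
      refine ⟨Z, ζ, j ≫ i, mono_comp _ _, ?_, hm⟩
      rw [F.map_comp, FintypeCat.comp_apply, hζ, hω]

/-- For every object `X` there is a galois object over `X` from which every point of the fiber
of `X` is reached. -/
lemma exists_galoisObject [HasFiniteLimits C] [F.ReflectsIsomorphisms] (X : C) :
    ∃ Γ : GaloisObject F, ∀ x : F.obj X, ∃ f : Γ.X ⟶ X, F.map f Γ.ξ = x := by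
  -- The tautological point of the power $X^{F(X)}$: its coordinate at `x` is `x`. The galois object
  -- is a minimal subobject through it.
  obtain ⟨z, hz⟩ := exists_pi_point (F := F) (fun _ : F.obj X => X) fun x => x
  obtain ⟨Y, ξ, j, hj, hξ, hm⟩ := exists_isMinimal _ z
  have hπ : ∀ x : F.obj X, F.map (j ≫ Pi.π (fun _ : F.obj X => X) x) ξ = x := fun x => by
    rw [F.map_comp, FintypeCat.comp_apply, hξ, hz]
  refine ⟨⟨Y, ξ, hm, fun f g h => hm.hom_ext h, fun η => ?_⟩, fun x => ⟨_, hπ x⟩⟩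
  -- The coordinates of `η` form a self-map of `F.obj X`. Reindexing the power along this map sends
  -- the tautological point to the image of `η`.
  let L : (∏ᶜ fun _ : F.obj X => X) ⟶ ∏ᶜ fun _ : F.obj X => X :=
    Pi.lift fun x => Pi.π (fun _ : F.obj X => X) (F.map (j ≫ Pi.π (fun _ : F.obj X => X) x) η)
  have hL : F.map (j ≫ L) ξ = F.map j η := by
    refine pi_point_ext _ _ _ fun x => ?_
    rw [← FintypeCat.comp_apply, ← FintypeCat.comp_apply, ← F.map_comp, ← F.map_comp,
      Category.assoc, Pi.lift_π, hπ]
  obtain ⟨p, hp1, hp2⟩ := exists_pullback_point (j ≫ L) j ξ η hL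
  -- The preimage of `Y` under `j ≫ L` is a subobject of `Y` through `ξ`. By minimality it is all of
  -- `Y`, so `L` restricts to an endomorphism of `Y` with `ξ ↦ η`.
  have : IsIso (pullback.fst (j ≫ L) j) := hm _ _ inferInstance ⟨p, hp1⟩
  refine ⟨inv (pullback.fst (j ≫ L) j) ≫ pullback.snd (j ≫ L) j, ?_⟩
  change F.map _ ξ = η
  rw [← hp1, ← FintypeCat.comp_apply, ← F.map_comp, IsIso.hom_inv_id_assoc, hp2]

end

/-- The image of `p` is a subobject through `ξ`, hence all of `X`, and epimorphisms are surjective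
on fibers. -/
lemma IsMinimal.surjective (hF : IsSemiGalois F) {X Y : C} {ξ : F.obj X} (h : IsMinimal F X ξ)
    (p : Y ⟶ X) (hp : ξ ∈ Set.range (F.map p)) : Function.Surjective (F.map p) := by
  have := hF.preservesFiniteColimits
  obtain ⟨Z, e, j, he, hj, rfl⟩ := hF.factorization p
  obtain ⟨y, hy⟩ := hp
  rw [F.map_comp] at hy ⊢
  have : IsIso j := h _ _ hj ⟨F.map e y, hy⟩
  exact (ConcreteCategory.bijective_of_isIso (F.map j)).2.comp (map_surjective_of_epi e)

/-! ### Transitivity of the action on minimal objects -/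

section

attribute [local instance] FiberEnd.fiberTopology FiberEnd.fiber_discrete

/-- The fundamental monoid acts transitively on the fiber of a minimal object. -/
lemma IsMinimal.exists_eval_eq (hF : IsSemiGalois F) {X : C} {ξ : F.obj X} (h : IsMinimal F X ξ)
    (η : F.obj X) : ∃ φ : FiberEnd F, φ.eval X ξ = η := by
  have := hF.hasFiniteLimits
  have := hF.preservesFiniteLimits
  have := hF.reflectsIsomorphisms
  -- Naturality is imposed only at the point `p.2`. A family lying in every `K p` is a natural
  -- endomorphism carrying `ξ` to `η`.
  let K (p : Σ Z : C, F.obj Z) : Set (∀ X : C, F.obj X → F.obj X) :=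
    {a | a X ξ = η ∧ ∀ (W : C) (q : p.1 ⟶ W), a W (F.map q p.2) = F.map q (a p.1 p.2)}
  have hmono : ∀ {p p' : Σ Z : C, F.obj Z} (r : p'.1 ⟶ p.1), F.map r p'.2 = p.2 → K p' ⊆ K p := by
    rintro ⟨Z, ζ⟩ ⟨Z', ζ'⟩ (r : Z' ⟶ Z) (rfl : F.map r ζ' = ζ) a ⟨ha, ha'⟩
    refine ⟨ha, fun W q => ?_⟩
    have h1 := ha' W (r ≫ q)
    rw [F.map_comp, FintypeCat.comp_apply, FintypeCat.comp_apply] at h1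
    exact h1.trans (congrArg _ (ha' _ r).symm)
  have hdir : Directed (· ⊇ ·) K := by
    rintro ⟨Z, ζ⟩ ⟨Z', ζ'⟩
    obtain ⟨z, h1, h2⟩ := exists_prod_point Z Z' ζ ζ'
    exact ⟨⟨Z ⨯ Z', z⟩, hmono prod.fst h1, hmono prod.snd h2⟩
  have hne : ∀ p, (K p).Nonempty := by
    rintro ⟨Z₀, ζ₀⟩
    -- A minimal object `(Z, ζ)` over both `(Z₀, ζ₀)` and `(X, ξ)`: since `Z → X` is surjective on
    -- fibers, `η` lifts to a point `ζ'` of `Z`.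
    obtain ⟨z, h1, h2⟩ := exists_prod_point Z₀ X ζ₀ ξ
    obtain ⟨Z, ζ, j, hj, hζ, hm⟩ := exists_isMinimal _ z
    have hr : F.map (j ≫ prod.fst) ζ = ζ₀ := by rw [F.map_comp, FintypeCat.comp_apply, hζ, h1]
    have hp : F.map (j ≫ prod.snd) ζ = ξ := by rw [F.map_comp, FintypeCat.comp_apply, hζ, h2]
    obtain ⟨ζ', hζ'⟩ := h.surjective hF (j ≫ prod.snd) ⟨ζ, hp⟩ η
    refine Set.Nonempty.mono (hmono (p' := ⟨Z, ζ⟩) _ hr) ?_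
    classical
    -- The forced value at $F(q)(\zeta)$ is $F(q)(\zeta')$; it is well defined because minimality
    -- recovers `q` from $F(q)(\zeta)$. The value at other points is immaterial.
    let a : ∀ X : C, F.obj X → F.obj X := fun W w =>
      if hw : ∃ q : Z ⟶ W, F.map q ζ = w then F.map hw.choose ζ' else w
    have ha : ∀ (W : C) (q : Z ⟶ W), a W (F.map q ζ) = F.map q ζ' := by
      intro W q
      have hw : ∃ q' : Z ⟶ W, F.map q' ζ = F.map q ζ := ⟨q, rfl⟩
      rw [show a W (F.map q ζ) = F.map hw.choose ζ' from dif_pos hw,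
        hm.hom_ext hw.choose_spec]
    have ha' : a Z ζ = ζ' := by simpa using ha Z (𝟙 Z)
    refine ⟨a, ?_, fun W q => ?_⟩
    · rw [← hζ', ← ha X (j ≫ prod.snd), hp]
    · exact (ha W q).trans (congrArg _ ha'.symm)
  have hcl : ∀ p, IsClosed (K p) := by
    intro p
    have hK : K p = {a | a X ξ = η} ∩ ⋂ (W : C) (q : p.1 ⟶ W),
        {a | a W (F.map q p.2) = F.map q (a p.1 p.2)} := by
      ext a
      simp [K]
    rw [hK]
    refine IsClosed.inter ?_ (isClosed_iInter fun W => isClosed_iInter fun q => ?_)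
    · exact isClosed_eq ((continuous_apply ξ).comp (continuous_apply X)) continuous_const
    · refine isClosed_eq ?_ ?_
      · exact (continuous_apply _).comp (continuous_apply W)
      · exact (continuous_of_discreteTopology (f := F.map q)).comp
          ((continuous_apply _).comp (continuous_apply p.1))
  have : Nonempty (Σ Z : C, F.obj Z) := ⟨⟨X, ξ⟩⟩
  -- The ambient space is compact by Tychonoff, the fibers being finite.
  obtain ⟨a, ha⟩ := IsCompact.nonempty_iInter_of_directed_nonempty_isCompact_isClosed K hdir hne
    (fun p => (hcl p).isCompact) hcl
  rw [Set.mem_iInter] at ha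
  exact ⟨{ app := fun W => FintypeCat.homMk (a W)
           naturality := fun W W' f => FintypeCat.hom_ext _ _ fun w => (ha ⟨W, w⟩).2 W' f },
    (ha ⟨X, ξ⟩).1⟩

end

end FiberFunctor

/-! ### The fundamental monoid as an inverse limit over the galois objects -/

namespace FiberFunctor

variable {C : Type*} [Category* C] {F : C ⥤ FintypeCat.{u}}

/-- The endomorphism of a galois object `(X, ξ)` that acts on `ξ` as `φ` does. -/
noncomputable def galoisEndo (φ : FiberEnd F) (Γ : GaloisObject F) : End Γ.X :=
  (Γ.bijective.2 (φ.eval Γ.X Γ.ξ)).choose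

lemma map_galoisEndo (φ : FiberEnd F) (Γ : GaloisObject F) :
    F.map (galoisEndo φ Γ) Γ.ξ = φ.eval Γ.X Γ.ξ :=
  (Γ.bijective.2 (φ.eval Γ.X Γ.ξ)).choose_spec

lemma galoisEndo_eq {φ : FiberEnd F} {Γ : GaloisObject F} {f : End Γ.X}
    (h : F.map f Γ.ξ = φ.eval Γ.X Γ.ξ) : galoisEndo φ Γ = f :=
  Γ.bijective.1 ((map_galoisEndo φ Γ).trans h.symm)

lemma t2Space_galoisLimit : T2Space (galoisLimit F) := by
  let _ (Γ : GaloisObject F) : TopologicalSpace (End Γ.X) := ⊥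
  have (Γ : GaloisObject F) : DiscreteTopology (End Γ.X) := ⟨rfl⟩
  exact IsEmbedding.t2Space (f := Subtype.val (p := fun v => v ∈ galoisLimit F))
    ⟨⟨rfl⟩, Subtype.val_injective⟩

variable [HasFiniteLimits C] [PreservesFiniteLimits F]

/-- By naturality of `φ` both composites agree at the distinguished point, which determines arrows
out of a minimal object. -/
lemma galoisEndo_mem (φ : FiberEnd F) : (fun Γ => galoisEndo φ Γ) ∈ galoisLimit F := by
  intro Γ Γ' l hl
  refine IsMinimal.hom_ext Γ.minimal ?_
  rw [F.map_comp, F.map_comp, FintypeCat.comp_apply, FintypeCat.comp_apply, map_galoisEndo,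
    FiberEnd.eval_naturality, hl, map_galoisEndo]

variable (F) in
/-- The action of the natural endomorphisms of `F` on the distinguished points of the galois
objects. -/
noncomputable def toGaloisLimit : FiberEnd F →* galoisLimit F where
  toFun φ := ⟨fun Γ => galoisEndo φ Γ, galoisEndo_mem φ⟩
  map_one' := Subtype.ext (funext fun Γ => galoisEndo_eq (by
    change F.map (𝟙 _) Γ.ξ = Γ.ξ
    simp))
  map_mul' φ ψ := Subtype.ext (funext fun Γ => galoisEndo_eq (by
    -- Naturality of `ψ` along `galoisEndo φ Γ` reverses the order of composition, matching `u * v =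
    -- v ≫ u` in `End Γ.X`.
    change F.map (galoisEndo ψ Γ ≫ galoisEndo φ Γ) Γ.ξ = ψ.eval _ (φ.eval _ Γ.ξ)
    rw [F.map_comp, FintypeCat.comp_apply, map_galoisEndo, ← map_galoisEndo φ,
      FiberEnd.eval_naturality]))

lemma continuous_toGaloisLimit : Continuous (toGaloisLimit F) := by
  refine continuous_induced_rng.2 ((@continuous_pi_iff _ _ _ _ (fun _ => ⊥) _).2 fun Γ => ?_)
  have h1 := FiberEnd.continuous_eval F Γ.X Γ.ξ
  let _ := FiberEnd.fiberTopology F Γ.X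
  have := FiberEnd.fiber_discrete F Γ.X
  let _ : TopologicalSpace (End Γ.X) := ⊥
  exact (continuous_of_discreteTopology
    (f := fun x => (Γ.bijective.2 x).choose)).comp h1

variable [F.ReflectsIsomorphisms]

lemma exists_galoisObject_hom (X : C) (x : F.obj X) :
    ∃ (Γ : GaloisObject F) (f : Γ.X ⟶ X), F.map f Γ.ξ = x := by
  obtain ⟨Γ, h⟩ := exists_galoisObject (F := F) X
  exact ⟨Γ, h x⟩

lemma toGaloisLimit_injective : Function.Injective (toGaloisLimit F) := by
  intro φ ψ h
  refine FiberEnd.eval_injective F (funext fun X => funext fun x => ?_)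
  obtain ⟨Γ, f, rfl⟩ := exists_galoisObject_hom X x
  have hΓ : galoisEndo φ Γ = galoisEndo ψ Γ := congrFun (congrArg Subtype.val h) Γ
  change φ.eval X _ = ψ.eval X _
  rw [← FiberEnd.eval_naturality, ← FiberEnd.eval_naturality, ← map_galoisEndo, hΓ,
    map_galoisEndo]

/-- This makes the action of `v` on a point of `X` independent of the galois object chosen above
that point: two choices are compared on a galois object over their product. -/
lemma map_galoisLimit_congr (v : galoisLimit F) {X : C} {Γ Γ' : GaloisObject F} (f : Γ.X ⟶ X)
    (f' : Γ'.X ⟶ X) (h : F.map f Γ.ξ = F.map f' Γ'.ξ) :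
    F.map f (F.map (v.1 Γ) Γ.ξ) = F.map f' (F.map (v.1 Γ') Γ'.ξ) := by
  obtain ⟨z, h1, h2⟩ := exists_prod_point Γ.X Γ'.X Γ.ξ Γ'.ξ
  obtain ⟨Δ, g, rfl⟩ := exists_galoisObject_hom _ z
  rw [← FintypeCat.comp_apply, ← F.map_comp] at h1 h2
  have hg : (g ≫ prod.fst) ≫ f = (g ≫ prod.snd) ≫ f' := by
    refine IsMinimal.hom_ext Δ.minimal ?_
    rw [F.map_comp, FintypeCat.comp_apply, h1, h, F.map_comp _ f', FintypeCat.comp_apply, h2]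
  have key : ∀ {Γ : GaloisObject F} (l : Δ.X ⟶ Γ.X) (f : Γ.X ⟶ X), F.map l Δ.ξ = Γ.ξ →
      F.map f (F.map (v.1 Γ) Γ.ξ) = F.map (v.1 Δ ≫ l ≫ f) Δ.ξ := by
    intro Γ l f hl
    rw [← Category.assoc, v.2 Δ Γ l hl, F.map_comp, F.map_comp, FintypeCat.comp_apply,
      FintypeCat.comp_apply, hl]
  rw [key _ f h1, key _ f' h2, hg]

lemma toGaloisLimit_surjective : Function.Surjective (toGaloisLimit F) := by
  intro v
  choose Γ f hf using fun (p : Σ X : C, F.obj X) => exists_galoisObject_hom p.1 p.2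
  -- Each point is acted on through a chosen galois object above it; naturality is independence of
  -- the choice.
  let φ : FiberEnd F :=
    { app := fun X => FintypeCat.homMk fun x => F.map (f ⟨X, x⟩) (F.map (v.1 (Γ ⟨X, x⟩)) (Γ ⟨X, x⟩).ξ)
      naturality := fun X Y g => FintypeCat.hom_ext _ _ fun x => by
        refine (map_galoisLimit_congr v (f ⟨Y, F.map g x⟩) (f ⟨X, x⟩ ≫ g) ?_).trans ?_
        · rw [hf, F.map_comp, FintypeCat.comp_apply, hf]
        · rw [F.map_comp, FintypeCat.comp_apply]
          rfl }
  refine ⟨φ, Subtype.ext (funext fun Δ => galoisEndo_eq ?_)⟩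
  refine Eq.trans ?_ (map_galoisLimit_congr v (𝟙 Δ.X) (f ⟨Δ.X, Δ.ξ⟩) ?_)
  · simp
  · rw [hf]
    simp

/-- The natural endomorphisms of `F` form the inverse limit of the monoids `End(X)` over the
galois objects `(X, ξ)`. -/
lemma exists_galoisLimit_equiv : ∃ e : FiberEnd F ≃ₜ* galoisLimit F,
    ∀ φ Γ, F.map ((e φ).1 Γ) Γ.ξ = φ.eval Γ.X Γ.ξ := by
  have := t2Space_galoisLimit (F := F)
  let e := MulEquiv.ofBijective (toGaloisLimit F)
    ⟨toGaloisLimit_injective, toGaloisLimit_surjective⟩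
  -- A continuous bijection from a compact to a Hausdorff space is a homeomorphism.
  let h := (continuous_toGaloisLimit (F := F)).homeoOfEquivCompactToT2 (f := e.toEquiv)
  exact ⟨{ e with continuous_toFun := h.continuous, continuous_invFun := h.symm.continuous },
    fun φ Γ => map_galoisEndo φ Γ⟩

end FiberFunctor

/-! ### The functor to the finite sets over the fundamental monoid -/

namespace FiberFunctor

section

variable {C : Type*} [Category* C] [EssentiallySmall.{u} C] (F : C ⥤ FintypeCat.{u})

/-- The natural endomorphisms of `F` as a profinite monoid. -/
noncomputable def profEnd : ProfMon.{u} where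
  -- The same data as in `fundMonoid`, so the two agree definitionally. The semi-galois axioms are
  -- not assumed, since for galois categories they are derived by means of this monoid.
  carrier := Shrink.{u} (FiberEnd F)
  continuousMul := ⟨by
    have h : Continuous fun p : Shrink.{u} (FiberEnd F) × Shrink.{u} (FiberEnd F) =>
        (Shrink.homeomorph _).symm p.1 * (Shrink.homeomorph _).symm p.2 := by fun_prop
    exact (Shrink.homeomorph _).continuous.comp h⟩
  compact := (Shrink.homeomorph _).compactSpace
  hausdorff := (Shrink.homeomorph _).t2Space
  totallyDisconnected := (Shrink.homeomorph _).totallyDisconnectedSpace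

/-- The identification of `profEnd F` with `End(F)`. -/
noncomputable def profEndEquiv : profEnd F ≃ₜ* FiberEnd F where
  toEquiv := (equivShrink _).symm
  map_mul' := equivShrink_symm_mul
  continuous_toFun := (Shrink.homeomorph _).symm.continuous
  continuous_invFun := (Shrink.homeomorph _).continuous

/-- The fiber `F(X)` as a finite set with an action of `End(F)`. -/
noncomputable def fiberMSet (X : C) : FinMSet (profEnd F) where
  carrier := F.obj X
  act x m := (profEndEquiv F m).eval X x
  act_mul x m n := by
    rw [map_mul]
    rfl
  act_one x := by
    rw [map_one]
    rfl
  continuous_act := by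
    let _ := FiberEnd.fiberTopology F X
    have := FiberEnd.fiber_discrete F X
    refine continuous_prod_of_discrete_left.2 fun x => ?_
    exact (FiberEnd.continuous_eval F X x).comp (profEndEquiv F).continuous_toFun

/-- The functor that equips the fibers of `F` with the action of `End(F)`. -/
noncomputable def toFinMSet : C ⥤ FinMSet (profEnd F) where
  obj X := fiberMSet F X
  map f := ⟨F.map f, fun x m => (profEndEquiv F m).eval_naturality f x⟩
  map_id X := FinMSet.hom_ext fun x => by
    change F.map (𝟙 X) x = x
    rw [F.map_id]
    rfl
  map_comp f g := FinMSet.hom_ext fun x => by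
    change F.map (f ≫ g) x = F.map g (F.map f x)
    rw [F.map_comp]
    rfl

/-- The underlying sets of the fibers are unchanged. -/
noncomputable def toFinMSetFiber : toFinMSet F ⋙ FinMSet.fiber (profEnd F) ≅ F :=
  NatIso.ofComponents (fun _ => Iso.refl _)

end


/-- The subobject is the image of the coproduct of minimal subobjects through the points of `S`. By
transitivity every point of such a minimal subobject is a translate of its distinguished point, so
stability keeps its image in `S`. -/
lemma exists_mono_range_eq {C : Type*} [Category* C] {F : C ⥤ FintypeCat.{u}}
    (hF : IsSemiGalois F) {X : C} (S : Set (F.obj X))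
    (hS : ∀ (φ : FiberEnd F), ∀ x ∈ S, φ.eval X x ∈ S) :
    ∃ (Z : C) (j : Z ⟶ X), Mono j ∧ Set.range (F.map j) = S := by
  have := hF.hasFiniteColimits
  have := hF.preservesFiniteLimits
  have := hF.preservesFiniteColimits
  have := hF.reflectsIsomorphisms
  choose Z ζ j _ hζ hm using fun s : S => exists_isMinimal X s.1
  obtain ⟨W, e, i, he, hi, hei⟩ := hF.factorization (Sigma.desc j)
  have hι : ∀ (s : S) (z : F.obj (Z s)), F.map i (F.map e (F.map (Sigma.ι Z s) z)) =
      F.map (j s) z := fun s z => by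
    simp only [← FintypeCat.comp_apply, ← F.map_comp, Category.assoc, hei,
      Sigma.ι_desc]
  refine ⟨W, i, hi, Set.Subset.antisymm ?_ fun s hs => ⟨_, (hι ⟨s, hs⟩ (ζ ⟨s, hs⟩)).trans (hζ _)⟩⟩
  rintro _ ⟨w, rfl⟩
  obtain ⟨y, rfl⟩ := map_surjective_of_epi (F := F) e w
  obtain ⟨s, z, rfl⟩ := exists_sigma_point Z y
  obtain ⟨φ, rfl⟩ := (hm s).exists_eval_eq hF z
  rw [hι, FiberEnd.eval_naturality, hζ]
  exact hS φ _ s.2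

section

variable {C : Type*} [Category* C] [EssentiallySmall.{u} C] {F : C ⥤ FintypeCat.{u}}

lemma toFinMSet_faithful (hF : IsSemiGalois F) : (toFinMSet F).Faithful := by
  have := hF.hasFiniteLimits
  have := hF.preservesFiniteLimits
  have := hF.reflectsIsomorphisms
  have := faithful (F := F)
  exact ⟨fun {X Y f g} h => F.map_injective (FintypeCat.hom_ext _ _ fun x =>
    congrFun (congrArg FinMSet.Hom.toFun h) x)⟩

/-- The graph of an equivariant map is stable, hence the fiber of a subobject of `X ⨯ Y`. Its
projection to `X` is bijective on fibers, so the subobject is the graph of an arrow. -/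
lemma toFinMSet_full (hF : IsSemiGalois F) : (toFinMSet F).Full where
  map_surjective {X Y} h := by
    have := hF.hasFiniteLimits
    have := hF.preservesFiniteLimits
    have := hF.reflectsIsomorphisms
    let k : F.obj X → F.obj Y := h.toFun
    have hk : ∀ (φ : FiberEnd F) (x : F.obj X), k (φ.eval X x) = φ.eval Y (k x) := fun φ x => by
      obtain ⟨m, rfl⟩ := (profEndEquiv F).surjective φ
      exact h.map_act x m
    obtain ⟨Z, j, hj, hr⟩ := exists_mono_range_eq hF
      {z : F.obj (X ⨯ Y) | k (F.map prod.fst z) = F.map prod.snd z} (by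
        intro φ z hz
        change k _ = _ at hz
        change k _ = _
        rw [FiberEnd.eval_naturality, FiberEnd.eval_naturality, hk, hz])
    have hjk : ∀ z, k (F.map (j ≫ prod.fst) z) = F.map (j ≫ prod.snd) z := fun z => by
      have : F.map j z ∈ {z : F.obj (X ⨯ Y) | k (F.map prod.fst z) = F.map prod.snd z} :=
        hr ▸ ⟨z, rfl⟩
      simpa using this
    have hp : IsIso (j ≫ prod.fst) := by
      refine isIso_of_bijective (F := F) _ ⟨fun z z' hz => ?_, fun x => ?_⟩
      · refine map_injective_of_mono (F := F) j (prod_point_ext _ _ _ _ ?_ ?_)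
        · simpa using hz
        · have := congrArg k hz
          rw [hjk, hjk] at this
          simpa using this
      · obtain ⟨z, h1, h2⟩ := exists_prod_point X Y x (k x)
        have : z ∈ Set.range (F.map j) := by
          rw [hr]
          change k _ = _
          rw [h1, h2]
        obtain ⟨w, rfl⟩ := this
        exact ⟨w, by simpa using h1⟩
    refine ⟨inv (j ≫ prod.fst) ≫ j ≫ prod.snd, FinMSet.hom_ext fun (x : F.obj X) => ?_⟩
    change F.map _ x = k x
    rw [F.map_comp, FintypeCat.comp_apply, ← hjk, ← FintypeCat.comp_apply, ← F.map_comp,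
      IsIso.inv_hom_id, F.map_id, FintypeCat.id_apply]

/-- Pointed objects distinguish all elements of `profEnd F`, and the action on `S` is locally
constant; by compactness a single pointed object suffices for `S`. -/
lemma exists_point_controlling (hF : IsSemiGalois F) (S : FinMSet (profEnd F)) :
    ∃ (Z : C) (ζ : F.obj Z), IsMinimal F Z ζ ∧ ∀ m n : profEnd F,
      (profEndEquiv F m).eval Z ζ = (profEndEquiv F n).eval Z ζ →
        ∀ s, S.act s m = S.act s n := by
  have := hF.hasFiniteLimits
  have := hF.preservesFiniteLimits
  have := hF.reflectsIsomorphisms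
  suffices h : ∃ p : Σ Z : C, F.obj Z, ∀ m n : profEnd F,
      (profEndEquiv F m).eval p.1 p.2 = (profEndEquiv F n).eval p.1 p.2 →
        S.actHom m = S.actHom n by
    obtain ⟨⟨X, ξ⟩, h⟩ := h
    obtain ⟨Z, ζ, j, -, rfl, hm⟩ := exists_isMinimal X ξ
    refine ⟨Z, ζ, hm, fun m n hmn s => ConcreteCategory.congr_hom (h m n ?_) s⟩
    rw [← FiberEnd.eval_naturality, ← FiberEnd.eval_naturality, hmn]
  by_contra! hcon
  -- Pairs that agree at `p` but act differently on `S`. A pair in every `K p` would consist of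
  -- equal elements, a contradiction.
  let K (p : Σ Z : C, F.obj Z) : Set (profEnd F × profEnd F) :=
    {q | (profEndEquiv F q.1).eval p.1 p.2 = (profEndEquiv F q.2).eval p.1 p.2} ∩
      {q | S.actHom q.1 ≠ S.actHom q.2}
  have hmono : ∀ {Z Z' : C} (r : Z' ⟶ Z) (ζ' : F.obj Z'), K ⟨Z', ζ'⟩ ⊆ K ⟨Z, F.map r ζ'⟩ := by
    rintro Z Z' r ζ' ⟨m, n⟩ ⟨h1, h2⟩
    refine ⟨?_, h2⟩
    change (profEndEquiv F m).eval Z' ζ' = (profEndEquiv F n).eval Z' ζ' at h1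
    change (profEndEquiv F m).eval Z _ = (profEndEquiv F n).eval Z _
    rw [← FiberEnd.eval_naturality, ← FiberEnd.eval_naturality, h1]
  have hdir : Directed (· ⊇ ·) K := by
    rintro ⟨Z, ζ⟩ ⟨Z', ζ'⟩
    obtain ⟨z, rfl, rfl⟩ := exists_prod_point Z Z' ζ ζ'
    exact ⟨⟨Z ⨯ Z', z⟩, hmono prod.fst z, hmono prod.snd z⟩
  have hcl : ∀ p, IsClosed (K p) := by
    rintro ⟨Z, ζ⟩
    refine IsClosed.inter ?_ ?_
    · let _ := FiberEnd.fiberTopology F Z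
      have := FiberEnd.fiber_discrete F Z
      have h := (FiberEnd.continuous_eval F Z ζ).comp (profEndEquiv F).continuous_toFun
      exact isClosed_eq (h.comp continuous_fst) (h.comp continuous_snd)
    · have h : IsLocallyConstant S.actHom :=
        (IsLocallyConstant.iff_eventually_eq _).2 fun m => S.actHom_eventually m
      have h2 : IsLocallyConstant fun q : profEnd F × profEnd F => (S.actHom q.1, S.actHom q.2) :=
        (h.comp_continuous continuous_fst).prodMk (h.comp_continuous continuous_snd)
      exact isOpen_compl_iff.1 (h2 {q | q.1 ≠ q.2}ᶜ)
  have : Nonempty (Σ Z : C, F.obj Z) := by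
    have := hF.hasTerminal
    obtain ⟨h⟩ := hF.obj_terminal
    exact ⟨⟨⊤_ C, h.default⟩⟩
  obtain ⟨⟨m, n⟩, hmn⟩ := IsCompact.nonempty_iInter_of_directed_nonempty_isCompact_isClosed K hdir
    (fun p => by
      obtain ⟨m, n, h1, h2⟩ := hcon p
      exact ⟨(m, n), h1, h2⟩) (fun p => (hcl p).isCompact) hcl
  rw [Set.mem_iInter] at hmn
  refine (hmn (Classical.arbitrary _)).2 (congrArg S.actHom ?_)
  exact (profEndEquiv F).injective (FiberEnd.eval_injective F (funext fun X => funext fun x =>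
    (hmn ⟨X, x⟩).1))

/-- The kernel pair of `π` is stable, so it is the fiber of a subobject `R` of `T ⨯ T`. As `F`
preserves the coequalizer of `R ⇉ T`, the fiber of that coequalizer is the quotient `S`. -/
lemma exists_iso_of_surjective (hF : IsSemiGalois F) (T : C) (S : FinMSet (profEnd F))
    (π : fiberMSet F T ⟶ S) (hπ : Function.Surjective π.toFun) :
    ∃ Q : C, Nonempty ((toFinMSet F).obj Q ≅ S) := by
  have := hF.hasFiniteLimits
  have := hF.hasFiniteColimits
  have := hF.preservesFiniteLimits
  have := hF.preservesFiniteColimits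
  let k : F.obj T ⟶ FintypeCat.of S.carrier := FintypeCat.homMk π.toFun
  have hk : ∀ (m : profEnd F) (x : F.obj T), k ((profEndEquiv F m).eval T x) = S.act (k x) m :=
    fun m x => π.map_act x m
  obtain ⟨R, j, hj, hr⟩ := exists_mono_range_eq hF
    {z : F.obj (T ⨯ T) | k (F.map prod.fst z) = k (F.map prod.snd z)} (by
      intro φ z hz
      change k _ = k _ at hz
      change k _ = k _
      rw [FiberEnd.eval_naturality, FiberEnd.eval_naturality,
        ← (profEndEquiv F).apply_symm_apply φ, hk, hk, hz])
  let q := coequalizer.π (j ≫ prod.fst) (j ≫ prod.snd)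
  have hq := coequalizer.condition (j ≫ prod.fst) (j ≫ prod.snd)
  let hl := isColimitCoforkMapOfIsColimit F hq
    (coequalizerIsCoequalizer (j ≫ prod.fst) (j ≫ prod.snd))
  have hw : F.map (j ≫ prod.fst) ≫ k = F.map (j ≫ prod.snd) ≫ k := by
    refine FintypeCat.hom_ext _ _ fun z => ?_
    have : F.map j z ∈ {z : F.obj (T ⨯ T) | k (F.map prod.fst z) = k (F.map prod.snd z)} :=
      hr ▸ ⟨z, rfl⟩
    simpa using this
  let d : F.obj (coequalizer (j ≫ prod.fst) (j ≫ prod.snd)) ⟶ FintypeCat.of S.carrier :=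
    hl.desc (Cofork.ofπ k hw)
  have hd : ∀ x, d (F.map q x) = k x := fun x =>
    ConcreteCategory.congr_hom (hl.fac (Cofork.ofπ k hw) WalkingParallelPair.one) x
  have hs : Function.Surjective (F.map q) := map_surjective_of_epi q
  let D : (toFinMSet F).obj (coequalizer (j ≫ prod.fst) (j ≫ prod.snd)) ⟶ S :=
    { toFun := d
      map_act := fun y m => by
        obtain ⟨x, rfl⟩ := hs y
        change d ((profEndEquiv F m).eval _ (F.map q x)) = _
        rw [← FiberEnd.eval_naturality, hd, hd, hk] }
  have hD : Function.Bijective ((FinMSet.fiber _).map D) := by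
    refine ⟨fun y y' hy => ?_, fun s => ?_⟩
    · obtain ⟨x, rfl⟩ := hs y
      obtain ⟨x', rfl⟩ := hs y'
      change d _ = d _ at hy
      rw [hd, hd] at hy
      obtain ⟨z, rfl, rfl⟩ := exists_prod_point T T x x'
      have : z ∈ Set.range (F.map j) := by
        rw [hr]
        exact hy
      obtain ⟨w, rfl⟩ := this
      have h : F.map q (F.map prod.fst (F.map j w)) = F.map q (F.map prod.snd (F.map j w)) := by
        simpa using ConcreteCategory.congr_hom (congrArg F.map hq) w
      exact h
    · obtain ⟨x, rfl⟩ := hπ s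
      exact ⟨F.map q x, hd x⟩
  have : IsIso D := isIso_of_bijective (F := FinMSet.fiber _) D hD
  exact ⟨_, ⟨asIso D⟩⟩

/-- One copy of the controlling object `Z` for each `i` in `S` maps onto the orbit of `i` by $\zeta
m\mapsto i m$; together the copies cover `S`. -/
lemma toFinMSet_essSurj (hF : IsSemiGalois F) : (toFinMSet F).EssSurj where
  mem_essImage S := by
    have := hF.hasFiniteColimits
    have := hF.preservesFiniteColimits
    obtain ⟨Z, ζ, hm, hc⟩ := exists_point_controlling hF S
    have hex : ∀ z : F.obj Z, ∃ m : profEnd F, (profEndEquiv F m).eval Z ζ = z := fun z => by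
      obtain ⟨φ, hφ⟩ := hm.exists_eval_eq hF z
      exact ⟨(profEndEquiv F).symm φ, by simpa using hφ⟩
    -- `μ z` is any element carrying `ζ` to `z`; by `hc` the choice does not affect the action on
    -- `S`.
    choose μ hμ using hex
    let X : S.carrier → C := fun _ => Z
    let hl := isColimitOfPreserves F (coproductIsCoproduct X)
    let s : Cocone (Discrete.functor X ⋙ F) :=
      { pt := FintypeCat.of S.carrier
        ι := Discrete.natTrans fun i => FintypeCat.homMk fun z : F.obj Z => S.act i.as (μ z) }
    let d : F.obj (∐ X) ⟶ FintypeCat.of S.carrier := hl.desc s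
    have hd : ∀ (i : S.carrier) (m : profEnd F),
        d (F.map (Sigma.ι X i) ((profEndEquiv F m).eval Z ζ)) = S.act i m := fun i m =>
      (ConcreteCategory.congr_hom (hl.fac s ⟨i⟩) _).trans (hc _ _ (hμ _) i)
    obtain ⟨Q, hQ⟩ := exists_iso_of_surjective hF (∐ X) S
      { toFun := d
        map_act := fun x m => by
          obtain ⟨i, z, rfl⟩ := exists_sigma_point X x
          obtain ⟨n, rfl⟩ : ∃ n : profEnd F, (profEndEquiv F n).eval Z ζ = z := ⟨_, hμ z⟩
          rw [hd, S.act_mul, ← hd, map_mul]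
          exact congrArg d ((profEndEquiv F m).eval_naturality (Sigma.ι X i) _).symm }
      (fun i => ⟨_, (hd i 1).trans (S.act_one i)⟩)
    exact ⟨Q, hQ⟩

lemma toFinMSet_isEquivalence (hF : IsSemiGalois F) : (toFinMSet F).IsEquivalence where
  faithful := toFinMSet_faithful hF
  full := toFinMSet_full hF
  essSurj := toFinMSet_essSurj hF

end

end FiberFunctor

/-! ### The fundamental monoid of the category of finite `M`-sets -/

namespace FinMSet

variable {M : ProfMon.{u}}

/-- The quotient of `M` by a right congruence with open classes. -/
def cyclic (D : DiscreteQuotient M)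
    (hD : ∀ m n k : M, D.toSetoid m n → D.toSetoid (m * k) (n * k)) : FinMSet M where
  carrier := D
  act x k := Quotient.map (· * k) (fun m n h => hD m n k h) x
  act_mul := by
    rintro ⟨x⟩ m n
    exact congrArg D.proj (mul_assoc x m n)
  act_one := by
    rintro ⟨x⟩
    exact congrArg D.proj (mul_one x)
  continuous_act := by
    let _ : TopologicalSpace D := ⊥
    have : DiscreteTopology D := ⟨rfl⟩
    refine continuous_prod_of_discrete_left.2 ?_
    rintro ⟨x⟩
    exact (D.proj_isLocallyConstant.comp_continuous (continuous_const_mul x)).continuous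

/-- The action of the elements of `M` on the finite `M`-sets. -/
def actEnd (M : ProfMon.{u}) : M →ₜ* FiberEnd (fiber M) where
  toFun m :=
    { app := fun X => X.actHom m
      naturality := fun _ _ f => (actHom_naturality f m).symm }
  map_one' := NatTrans.ext (funext fun X => X.actHom_one)
  map_mul' m n := NatTrans.ext (funext fun X => X.actHom_mul m n)
  continuous_toFun := (FiberEnd.continuous_iff _ _).2 fun X x => by
    let _ : TopologicalSpace X.carrier := ⊥
    exact X.continuous_act.comp (continuous_const.prodMk continuous_id)

/-- Clopen partitions separate the points of `M`. Each can be refined to an open right congruence,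
whose quotient is a finite `M`-set that detects the difference at the class of `1`. -/
lemma actEnd_injective : Function.Injective (actEnd M) := by
  intro m n h
  refine DiscreteQuotient.eq_of_forall_proj_eq fun D => ?_
  -- The largest right congruence contained in `D`. Its classes are open by the tube lemma, since
  -- `x` ranges over the compact space `M`.
  let E : DiscreteQuotient M :=
    { toSetoid := ⟨fun a b => ∀ x, D.proj (a * x) = D.proj (b * x),
        fun _ _ => rfl, fun h x => (h x).symm, fun h h' x => (h x).trans (h' x)⟩
      isOpen_setOfPred_rel := fun a => by
        refine isOpen_iff_eventually.2 fun b (hb : ∀ x, D.proj (a * x) = D.proj (b * x)) => ?_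
        have h : ∀ x ∈ (Set.univ : Set M),
            ∀ᶠ p : M × M in 𝓝 (b, x), D.proj (a * p.2) = D.proj (p.1 * p.2) := fun x _ => by
          have hc : Continuous fun p : M × M => (D.proj (a * p.2), D.proj (p.1 * p.2)) :=
            (D.proj_continuous.comp (by fun_prop)).prodMk (D.proj_continuous.comp (by fun_prop))
          exact ((isOpen_discrete {q : D × D | q.1 = q.2}).preimage hc).mem_nhds (hb x)
        filter_upwards [isCompact_univ.eventually_forall_of_forall_eventually
          (P := fun c x => D.proj (a * x) = D.proj (c * x)) h] with c hc x
        exact hc x (Set.mem_univ x) }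
  have hE : ∀ a b k : M, E.toSetoid a b → E.toSetoid (a * k) (b * k) := fun a b k h x => by
    rw [mul_assoc, mul_assoc]
    exact h (k * x)
  have h1 : (cyclic E hE).act (E.proj 1) m = (cyclic E hE).act (E.proj 1) n :=
    congrArg (fun φ : FiberEnd (fiber M) => φ.eval (cyclic E hE) (E.proj 1)) h
  have h2 : E.toSetoid (1 * m) (1 * n) := Quotient.exact h1
  simpa using h2 1

/-- Acting as `φ` does at a given point is a closed condition on `m`, so by compactness only
finitely many points need be treated together. -/
lemma actEnd_surjective : Function.Surjective (actEnd M) := by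
  intro φ
  have hcont : ∀ p : Σ X : FinMSet M, X.carrier, IsLocallyConstant fun m => p.1.act p.2 m :=
    fun p => (IsLocallyConstant.iff_eventually_eq _).2 fun m => by
      filter_upwards [p.1.actHom_eventually m] with n hn
      exact ConcreteCategory.congr_hom hn p.2
  let T (p : Σ X : FinMSet M, X.carrier) : Set M := {m | p.1.act p.2 m = φ.eval p.1 p.2}
  have hT : ∀ p, IsClosed (T p) := fun p => (hcont p).isClosed_fiber _
  have hne : (⋂ p, T p).Nonempty := by
    refine CompactSpace.iInter_nonempty hT fun s => ?_
    -- Elements are identified when they act alike on the points of `s`. `φ` moves the class of `1`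
    -- in this quotient to the class of some `m`, and this `m` works on `s`.
    let D : DiscreteQuotient M :=
      { toSetoid := ⟨fun a b => ∀ p ∈ s, p.1.act p.2 a = p.1.act p.2 b,
          fun _ _ _ => rfl, fun h p hp => (h p hp).symm, fun h h' p hp => (h p hp).trans (h' p hp)⟩
        isOpen_setOfPred_rel := fun a => by
          refine isOpen_iff_eventually.2 fun b (hb : ∀ p ∈ s, p.1.act p.2 a = p.1.act p.2 b) => ?_
          have h : ∀ᶠ c in 𝓝 b, ∀ p ∈ s, p.1.act p.2 c = p.1.act p.2 b :=
            (Filter.eventually_all_finset s).2 fun p _ =>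
              (IsLocallyConstant.iff_eventually_eq _).1 (hcont p) b
          filter_upwards [h] with c hc p hp
          exact (hb p hp).trans (hc p hp).symm }
    have hD : ∀ a b k : M, D.toSetoid a b → D.toSetoid (a * k) (b * k) := fun a b k h p hp => by
      rw [← p.1.act_mul, ← p.1.act_mul, h p hp]
    obtain ⟨m, hm⟩ := D.proj_surjective (φ.eval (cyclic D hD) (D.proj 1))
    refine ⟨m, Set.mem_iInter₂.2 fun p hp => ?_⟩
    -- The orbit map of `p.2`; naturality of `φ` along it transfers the choice of `m` to `p`.
    let g : cyclic D hD ⟶ p.1 :=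
      { toFun := Quotient.lift (fun m => p.1.act p.2 m) fun a b h => h p hp
        map_act := by
          rintro ⟨x⟩ k
          exact (p.1.act_mul _ _ _).symm }
    have h1 : g.toFun (φ.eval (cyclic D hD) (D.proj 1)) = φ.eval p.1 (p.1.act p.2 1) :=
      φ.eval_naturality g _
    rw [← hm, p.1.act_one] at h1
    exact h1
  obtain ⟨m, hm⟩ := hne
  rw [Set.mem_iInter] at hm
  exact ⟨m, FiberEnd.eval_injective _ (funext fun X => funext fun x => hm ⟨X, x⟩)⟩

variable (M) in
/-- A profinite monoid is the monoid of natural endomorphisms of the forgetful functor of its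
finite sets. -/
noncomputable def actEndEquiv : M ≃ₜ* FiberEnd (fiber M) :=
  let e := MulEquiv.ofBijective (actEnd M : M →* FiberEnd (fiber M))
    ⟨actEnd_injective, actEnd_surjective⟩
  let h := (actEnd M).continuous_toFun.homeoOfEquivCompactToT2 (f := e.toEquiv)
  { e with
    continuous_toFun := h.continuous
    continuous_invFun := h.symm.continuous }

end FinMSet

/-! ### Galois categories -/

/-- The axioms of a semi-galois category are invariant under equivalences. -/
lemma IsSemiGalois.of_equivalence {C D : Type*} [Category* C] [Category* D] (A : C ⥤ D)
    [A.IsEquivalence] {G : D ⥤ FintypeCat.{u}} (hG : IsSemiGalois G) {F : C ⥤ FintypeCat.{u}}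
    (i : A ⋙ G ≅ F) : IsSemiGalois F where
  hasInitial := have := hG.hasInitial; Adjunction.hasColimitsOfShape_of_equivalence A
  hasTerminal := have := hG.hasTerminal; Adjunction.hasLimitsOfShape_of_equivalence A
  hasPullbacks := have := hG.hasPullbacks; Adjunction.hasLimitsOfShape_of_equivalence A
  hasPushouts := have := hG.hasPushouts; Adjunction.hasColimitsOfShape_of_equivalence A
  factorization {X Y} f := by
    obtain ⟨Z, p, j, _, _, h⟩ := hG.factorization (A.map f)
    let e := A.objObjPreimageIso Z
    refine ⟨A.objPreimage Z, A.preimage (p ≫ e.inv), A.preimage (e.hom ≫ j), ?_, ?_, ?_⟩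
    · refine A.epi_of_epi_map ?_
      rw [A.map_preimage]
      infer_instance
    · refine A.mono_of_mono_map ?_
      rw [A.map_preimage]
      infer_instance
    · exact A.map_injective (by simpa using h)
  obj_initial := by
    have := hG.hasInitial
    have : HasInitial C := Adjunction.hasColimitsOfShape_of_equivalence A
    have := hG.obj_initial
    exact (FintypeCat.equivEquivIso.symm
      ((i.app _).symm ≪≫ G.mapIso (PreservesInitial.iso A))).isEmpty
  obj_terminal := by
    have := hG.hasTerminal
    have : HasTerminal C := Adjunction.hasLimitsOfShape_of_equivalence A
    obtain ⟨_⟩ := hG.obj_terminal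
    exact ⟨(FintypeCat.equivEquivIso.symm
      ((i.app _).symm ≪≫ G.mapIso (PreservesTerminal.iso A))).unique⟩
  preservesPullbacks := by
    have := hG.preservesPullbacks
    exact preservesLimitsOfShape_of_natIso i
  preservesPushouts := by
    have := hG.preservesPushouts
    exact preservesColimitsOfShape_of_natIso i
  reflectsIsomorphisms := ⟨fun f hf => by
    have := hG.reflectsIsomorphisms
    have : IsIso (G.map (A.map f)) := (NatIso.isIso_map_iff i f).2 hf
    have : IsIso (A.map f) := isIso_of_reflects_iso _ G
    exact isIso_of_reflects_iso f A⟩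

/-! ### Galois categories and invertibility of the fundamental monoid -/

namespace FiberFunctor

/-- In a semi-galois category whose fundamental monoid is a group, subobjects have complements. -/
lemma exists_complement {C : Type*} [Category* C] {F : C ⥤ FintypeCat.{u}} (hF : IsSemiGalois F)
    (hG : ∀ φ : FiberEnd F, IsUnit φ) {X Y : C} (i : X ⟶ Y) [Mono i] :
    ∃ (Z : C) (j : Z ⟶ Y), Nonempty (IsColimit (BinaryCofan.mk i j)) := by
  have := hF.hasFiniteColimits
  have := hF.preservesFiniteLimits
  have := hF.preservesFiniteColimits
  have := hF.reflectsIsomorphisms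
  -- The complement is stable: if $y\varphi=i(x)$, then $y=i(x\varphi^{-1})$ already lies in the
  -- image.
  obtain ⟨Z, j, _, hj⟩ := exists_mono_range_eq hF (Set.range (F.map i))ᶜ (by
    rintro φ y hy ⟨x, hx⟩
    obtain ⟨u, rfl⟩ := hG φ
    refine hy ⟨FiberEnd.eval (↑u⁻¹ : FiberEnd F) X x, ?_⟩
    rw [FiberEnd.eval_naturality, hx]
    change FiberEnd.eval ((u : FiberEnd F) * (↑u⁻¹ : FiberEnd F)) Y y = y
    rw [u.mul_inv]
    rfl)
  refine ⟨Z, j, ?_⟩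
  have hcof := isColimitOfPreserves F (coprodIsCoprod X Z)
  have hrep : ∀ w : F.obj (X ⨿ Z), (∃ x, F.map coprod.inl x = w) ∨ ∃ z, F.map coprod.inr z = w := by
    intro w
    obtain ⟨⟨_ | _⟩, x, hx⟩ := Concrete.isColimit_exists_rep _ hcof w
    · exact Or.inl ⟨x, hx⟩
    · exact Or.inr ⟨x, hx⟩
  have hl : ∀ x, F.map (coprod.desc i j) (F.map coprod.inl x) = F.map i x := fun x => by
    rw [← FintypeCat.comp_apply, ← F.map_comp, coprod.inl_desc]
  have hr : ∀ z, F.map (coprod.desc i j) (F.map coprod.inr z) = F.map j z := fun z => by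
    rw [← FintypeCat.comp_apply, ← F.map_comp, coprod.inr_desc]
  have hne : ∀ x z, F.map i x ≠ F.map j z := fun x z h =>
    (hj ▸ Set.mem_range_self z : F.map j z ∈ (Set.range (F.map i))ᶜ) ⟨x, h⟩
  have : IsIso (coprod.desc i j) := by
    refine isIso_of_bijective (F := F) _ ⟨fun w w' h => ?_, fun y => ?_⟩
    · obtain ⟨x, rfl⟩ | ⟨z, rfl⟩ := hrep w <;> obtain ⟨x', rfl⟩ | ⟨z', rfl⟩ := hrep w'
      · rw [hl, hl] at h
        rw [map_injective_of_mono i h]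
      · rw [hl, hr] at h
        exact (hne _ _ h).elim
      · rw [hr, hl] at h
        exact (hne _ _ h.symm).elim
      · rw [hr, hr] at h
        rw [map_injective_of_mono j h]
    · by_cases hy : y ∈ Set.range (F.map i)
      · obtain ⟨x, rfl⟩ := hy
        exact ⟨_, hl x⟩
      · rw [← Set.mem_compl_iff, ← hj] at hy
        obtain ⟨z, rfl⟩ := hy
        exact ⟨_, hr z⟩
  let e : X ⨿ Z ≅ Y := asIso (coprod.desc i j)
  refine ⟨IsColimit.ofIsoColimit (coprodIsCoprod X Z) (Cocone.ext e ?_)⟩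
  rintro ⟨_ | _⟩
  · exact coprod.inl_desc i j
  · exact coprod.inr_desc i j

lemma isGaloisWithFiber {C : Type*} [Category* C] {F : C ⥤ FintypeCat.{u}} (hF : IsSemiGalois F)
    (hG : ∀ φ : FiberEnd F, IsUnit φ) : IsGaloisWithFiber F := by
  have := hF.hasFiniteLimits
  have := hF.hasFiniteColimits
  have := hF.preservesFiniteLimits
  have := hF.preservesFiniteColimits
  have := hF.reflectsIsomorphisms
  have : PreGaloisCategory C :=
    { hasQuotientsByFiniteGroups := fun G _ _ => by
        -- An isomorphic copy of `G` in `Type` makes the quotient a finite colimit, whatever the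
        -- universe of `G`.
        obtain ⟨G', hg, hf, ⟨e⟩⟩ := Finite.exists_type_univ_nonempty_mulEquiv.{_, 0} G
        cases nonempty_fintype G'
        exact hasColimitsOfShape_of_equivalence e.toSingleObjEquiv.symm
      monoInducesIsoOnDirectSummand := fun i _ => exists_complement hF hG i }
  exact ⟨this,
    { preservesQuotientsByFiniteGroups := fun G _ _ => by
        obtain ⟨G', hg, hf, ⟨e⟩⟩ := Finite.exists_type_univ_nonempty_mulEquiv.{_, 0} G
        cases nonempty_fintype G'
        exact preservesColimitsOfShape_of_equiv e.toSingleObjEquiv.symm F }⟩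

section

variable {C : Type*} [Category.{u} C] {F : C ⥤ FintypeCat.{u}} [PreGaloisCategory C]
  [PreGaloisCategory.FiberFunctor F]

lemma isUnit_of_galois (φ : FiberEnd F) : IsUnit φ := by
  have : GaloisCategory C := ⟨F, ⟨inferInstance⟩⟩
  have : IsIso (φ : F ⟶ F) := PreGaloisCategory.FibreFunctor.end_isIso F φ
  exact ⟨⟨φ, (inv (φ : F ⟶ F) : F ⟶ F), IsIso.hom_inv_id _, IsIso.inv_hom_id _⟩, rfl⟩

variable (F) in
/-- An automorphism of `F` as a natural endomorphism. -/
def autToEnd (σ : Aut F) : FiberEnd F := σ.hom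

lemma autToEnd_surjective : Function.Surjective (autToEnd F) := fun φ => by
  have : GaloisCategory C := ⟨F, ⟨inferInstance⟩⟩
  have : IsIso (φ : F ⟶ F) := PreGaloisCategory.FibreFunctor.end_isIso F φ
  exact ⟨asIso (φ : F ⟶ F), rfl⟩

omit [PreGaloisCategory C] [PreGaloisCategory.FiberFunctor F] in
lemma continuous_autToEnd : Continuous (autToEnd F) := by
  refine (FiberEnd.continuous_iff _ _).2 fun X x => ?_
  let _ := FiberEnd.fiberTopology F X
  have := PreGaloisCategory.continuousSMul_aut_fiber F X
  exact (continuous_id.smul continuous_const : Continuous fun σ : Aut F => σ • x)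

variable [EssentiallySmall.{u} C]

/-- A finite set with an action of `End(F)` as a finite set with an action of `Aut(F)`. -/
noncomputable def actionOfMSet (S : FinMSet (profEnd F)) : Action FintypeCat.{u} (Aut F) where
  V := FintypeCat.of S.carrier
  ρ :=
    { toFun := fun σ => S.actHom ((profEndEquiv F).symm (autToEnd F σ))
      map_one' := by
        have : autToEnd F 1 = 1 := rfl
        rw [this, map_one]
        exact S.actHom_one
      map_mul' := fun σ τ => by
        -- `Aut F` acts on fibers from the left and `FiberEnd F` from the right, hence the reversed
        -- order.
        have : autToEnd F (σ * τ) = autToEnd F τ * autToEnd F σ := rfl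
        rw [this, map_mul]
        exact S.actHom_mul _ _ }

/-- Natural endomorphisms of `F` are automorphisms, so finite `End(F)`-sets are continuous finite
`Aut(F)`-sets and the classical equivalence carries over. -/
lemma toFinMSet_isEquivalence_of_galois : (toFinMSet F).IsEquivalence := by
  have : GaloisCategory C := ⟨F, ⟨inferInstance⟩⟩
  have hfaith : (toFinMSet F).Faithful :=
    ⟨fun {X Y f g} h => F.map_injective (FintypeCat.hom_ext _ _ fun x =>
      congrFun (congrArg FinMSet.Hom.toFun h) x)⟩
  have hfull : (toFinMSet F).Full := ⟨fun {X Y} h => by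
    have hk : ∀ (φ : FiberEnd F) (x : F.obj X), h.toFun (φ.eval X x) = φ.eval Y (h.toFun x) :=
      fun φ x => by
        obtain ⟨m, rfl⟩ := (profEndEquiv F).surjective φ
        exact h.map_act x m
    let k : (PreGaloisCategory.functorToAction F).obj X ⟶
        (PreGaloisCategory.functorToAction F).obj Y :=
      { hom := FintypeCat.homMk (X := F.obj X) (Y := F.obj Y) h.toFun
        comm := fun σ => FintypeCat.hom_ext _ _ fun x => hk (autToEnd F σ) x }
    obtain ⟨f, hf⟩ := (PreGaloisCategory.functorToAction F).map_surjective k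
    refine ⟨f, FinMSet.hom_ext fun x => ?_⟩
    exact ConcreteCategory.congr_hom (congrArg Action.Hom.hom hf) x⟩
  have hess : (toFinMSet F).EssSurj := ⟨fun S => by
    open scoped FintypeCatDiscrete in
    have hS : (actionOfMSet S).IsContinuous := by
      rw [Action.isContinuous_def]
      let _ : TopologicalSpace S.carrier := ⊥
      exact S.continuous_act.comp (continuous_snd.prodMk
        (((profEndEquiv F).symm.continuous_toFun.comp continuous_autToEnd).comp continuous_fst))
    obtain ⟨X, ⟨i⟩⟩ := Functor.EssSurj.mem_essImage
      (PreGaloisCategory.functorToContAction F) ⟨actionOfMSet S, hS⟩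
    let e : F.obj X ≅ FintypeCat.of S.carrier :=
      (ObjectProperty.ι _ ⋙ Action.forget _ _).mapIso i
    let D : (toFinMSet F).obj X ⟶ S :=
      { toFun := e.hom
        map_act := fun x m => by
          obtain ⟨σ, hσ⟩ := autToEnd_surjective (profEndEquiv F m)
          have h : e.hom ((autToEnd F σ).eval X x) =
              S.act (e.hom x) ((profEndEquiv F).symm (autToEnd F σ)) :=
            ConcreteCategory.congr_hom (i.hom.hom.comm σ) x
          rw [hσ, ContinuousMulEquiv.symm_apply_apply] at h
          exact h }
    have : IsIso D := isIso_of_bijective (F := FinMSet.fiber _) D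
      ((ConcreteCategory.isIso_iff_bijective e.hom).1 inferInstance)
    exact ⟨X, ⟨asIso D⟩⟩⟩
  exact { }

variable (F) in
lemma isSemiGalois_of_galois : IsSemiGalois F :=
  have := toFinMSet_isEquivalence_of_galois (F := F)
  IsSemiGalois.of_equivalence (toFinMSet F) (FinMSet.isSemiGalois _) (toFinMSetFiber F)

end

end FiberFunctor

/-! ### The duality -/

namespace ProfMon

/-- An isomorphism of topological monoids as an isomorphism of profinite monoids. -/
def isoOfEquiv {M N : ProfMon.{u}} (e : M ≃ₜ* N) : M ≅ N where
  hom := (e : M →ₜ* N)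
  inv := (e.symm : N →ₜ* M)
  hom_inv_id := ContinuousMonoidHom.ext fun m => e.symm_apply_apply m
  inv_hom_id := ContinuousMonoidHom.ext fun n => e.apply_symm_apply n

/-- A profinite monoid is isomorphic to the fundamental monoid of its finite sets. -/
noncomputable def isoFundMonoid (M : ProfMon.{u}) : M ≅ fundMonoid (FinMSet.semiGal M) :=
  isoOfEquiv ((FinMSet.actEndEquiv M).trans (fundMonoidEquiv (FinMSet.semiGal M)).symm)

lemma IsGroup.congr {M : ProfMon.{u}} {N : Type*} [Monoid N] (e : M ≃* N) :
    M.IsGroup ↔ ∀ n : N, IsUnit n := by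
  refine ⟨fun h n => ?_, fun h m => ?_⟩
  · obtain ⟨m, rfl⟩ := e.surjective n
    exact (h m).map e
  · rw [← e.symm_apply_apply m]
    exact (h (e m)).map e.symm

end ProfMon

/-- `π₁(B_f M)` is naturally isomorphic to `M`. -/
noncomputable def fundMonoidFinMSetIso : 𝟭 ProfMon.{u} ≅ finMSetFunctor ⋙ fundMonoidFunctor :=
  NatIso.ofComponents (fun M => ProfMon.isoFundMonoid M) fun {M N} f => by
    let g : M →ₜ* N := f
    refine ContinuousMonoidHom.ext fun m => ?_
    have h : (FinMSet.restrictExact f).endMap (FinMSet.actEnd M m) = FinMSet.actEnd N (g m) := rfl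
    have h' : fundMonoidEquiv (FinMSet.semiGal M)
        ((fundMonoidEquiv (FinMSet.semiGal M)).symm (FinMSet.actEnd M m)) = FinMSet.actEnd M m :=
      (fundMonoidEquiv (FinMSet.semiGal M)).apply_symm_apply _
    exact (congrArg (fundMonoidEquiv (FinMSet.semiGal N)).symm
      ((congrArg (FinMSet.restrictExact f).endMap h').trans h)).symm

namespace SemiGalExactFunctor

variable {X Y : SemiGal.{u}}

/-- The inverse of an exact functor whose underlying functor is an equivalence. -/
noncomputable def inverse (f : SemiGalExactFunctor X Y) [f.A.IsEquivalence] :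
    SemiGalExactFunctor Y X where
  A := f.A.inv
  -- $F_X A^{-1}\cong F_Y A A^{-1}\cong F_Y$, by $\sigma^{-1}$ and then the counit.
  σ := Functor.isoWhiskerLeft f.A.inv f.σ.symm ≪≫ (Functor.associator _ _ _).symm ≪≫
    Functor.isoWhiskerRight f.A.asEquivalence.counitIso Y.F ≪≫ Y.F.leftUnitor

/-- The triangle identity turns the counit at `A x` into `A` of the inverse unit, and naturality of
`σ` moves it past `σ`. -/
lemma comp_inverse_equiv (f : SemiGalExactFunctor X Y) [f.A.IsEquivalence] :
    f.comp f.inverse ≈ SemiGalExactFunctor.id X := by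
  refine ⟨f.A.asEquivalence.unitIso.symm, ?_⟩
  ext1; funext x
  refine FintypeCat.hom_ext _ _ fun w => ?_
  let v : Y.F.obj (f.A.obj (f.A.inv.obj (f.A.obj x))) := f.σ.inv.app (f.A.inv.obj (f.A.obj x)) w
  have h1 : f.A.asEquivalence.counitIso.hom.app (f.A.obj x) =
      f.A.map (f.A.asEquivalence.unitIso.inv.app x) :=
    f.A.asEquivalence.counit_app_functor x
  have h2 : f.σ.hom.app x (Y.F.map (f.A.map (f.A.asEquivalence.unitIso.inv.app x)) v) =
      X.F.map (f.A.asEquivalence.unitIso.inv.app x) (f.σ.hom.app _ v) :=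
    ConcreteCategory.congr_hom (f.σ.hom.naturality (f.A.asEquivalence.unitIso.inv.app x)) v
  have h3 : f.σ.hom.app _ v = w :=
    ConcreteCategory.congr_hom (f.σ.inv_hom_id_app (f.A.inv.obj (f.A.obj x))) w
  change X.F.map (f.A.asEquivalence.unitIso.inv.app x) w =
    f.σ.hom.app x (Y.F.map (f.A.asEquivalence.counitIso.hom.app (f.A.obj x)) v)
  exact ((congrArg (fun c => f.σ.hom.app x (Y.F.map c v)) h1).trans
    (h2.trans (congrArg _ h3))).symm

lemma inverse_comp_equiv (f : SemiGalExactFunctor X Y) [f.A.IsEquivalence] :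
    f.inverse.comp f ≈ SemiGalExactFunctor.id Y := by
  refine ⟨f.A.asEquivalence.counitIso, ?_⟩
  ext1; funext y
  refine FintypeCat.hom_ext _ _ fun (w : Y.F.obj (f.A.obj (f.A.inv.obj y))) => ?_
  have h : f.σ.inv.app (f.A.inv.obj y) (f.σ.hom.app (f.A.inv.obj y) w) = w :=
    ConcreteCategory.congr_hom (f.σ.hom_inv_id_app (f.A.inv.obj y)) w
  exact (congrArg (Y.F.map (f.A.asEquivalence.counitIso.hom.app y)) h).symm

/-- An exact functor whose underlying functor is an equivalence is an isomorphism. -/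
noncomputable def toIso (f : SemiGalExactFunctor X Y) [f.A.IsEquivalence] : X ≅ Y where
  hom := Quotient.mk _ f
  inv := Quotient.mk _ f.inverse
  hom_inv_id := Quotient.sound f.comp_inverse_equiv
  inv_hom_id := Quotient.sound f.inverse_comp_equiv

end SemiGalExactFunctor

namespace SemiGal

instance (X : SemiGal.{u}) : (FiberFunctor.toFinMSet X.F).IsEquivalence :=
  FiberFunctor.toFinMSet_isEquivalence X.isSemiGalois

/-- The exact functor to the finite sets over the fundamental monoid. -/
noncomputable def toFinMSetExact (X : SemiGal.{u}) :
    SemiGalExactFunctor X (FinMSet.semiGal (fundMonoid X)) where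
  A := FiberFunctor.toFinMSet X.F
  preservesFiniteLimits :=
    inferInstanceAs (PreservesFiniteLimits (FiberFunctor.toFinMSet X.F))
  preservesFiniteColimits :=
    inferInstanceAs (PreservesFiniteColimits (FiberFunctor.toFinMSet X.F))
  σ := FiberFunctor.toFinMSetFiber X.F

instance (X : SemiGal.{u}) : X.toFinMSetExact.A.IsEquivalence :=
  FiberFunctor.toFinMSet_isEquivalence X.isSemiGalois

/-- The functor to the finite sets over the fundamental monoid is natural. -/
noncomputable def toFinMSetNatIso {X Y : SemiGal.{u}} (f : SemiGalExactFunctor X Y) :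
    f.A ⋙ FiberFunctor.toFinMSet Y.F ≅
      FiberFunctor.toFinMSet X.F ⋙ FinMSet.restrict f.fundMonoidMap := by
  let g : fundMonoid Y →ₜ* fundMonoid X := f.fundMonoidMap
  have hm (m : fundMonoid Y) : fundMonoidEquiv X (g m) = f.endMap (fundMonoidEquiv Y m) :=
    (fundMonoidEquiv X).apply_symm_apply _
  let k (x : X.C) : (f.A ⋙ FiberFunctor.toFinMSet Y.F).obj x ⟶
      (FiberFunctor.toFinMSet X.F ⋙ FinMSet.restrict f.fundMonoidMap).obj x :=
    { toFun := f.σ.hom.app x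
      -- The element `m` acts on the target through $\sigma^{-1}\cdot\varphi A\cdot\sigma$, so
      -- equivariance of `σ` is the cancellation of $\sigma$ with $\sigma^{-1}$.
      map_act := fun w m => by
        change f.σ.hom.app x ((fundMonoidEquiv Y m).eval (f.A.obj x) w) =
          (fundMonoidEquiv X (g m)).eval x (f.σ.hom.app x w)
        refine Eq.trans ?_ (congrArg (fun φ : FiberEnd X.F => φ.eval x (f.σ.hom.app x w))
          (hm m)).symm
        have h : f.σ.inv.app x (f.σ.hom.app x w) = w :=
          ConcreteCategory.congr_hom (f.σ.hom_inv_id_app x) w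
        exact congrArg (fun w => f.σ.hom.app x ((fundMonoidEquiv Y m).eval (f.A.obj x) w)) h.symm }
  have hk (x : X.C) : IsIso (k x) := FiberFunctor.isIso_of_bijective (F := FinMSet.fiber _) _
    ((ConcreteCategory.isIso_iff_bijective (f.σ.hom.app x)).1 inferInstance)
  exact NatIso.ofComponents (fun x => @asIso _ _ _ _ (k x) (hk x)) fun g => FinMSet.hom_ext fun w =>
    ConcreteCategory.congr_hom (f.σ.hom.naturality g) w

/-- The naturality square of `finMSetFundMonoidIso`. The comparison has components `σ`, and neither
`toFinMSet` nor restriction changes underlying sets, so compatibility with the fibers is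
definitional. -/
lemma toFinMSetExact_naturality {X Y : SemiGal.{u}} (f : SemiGalExactFunctor X Y) :
    f.comp Y.toFinMSetExact ≈ X.toFinMSetExact.comp (FinMSet.restrictExact f.fundMonoidMap) := by
  refine ⟨toFinMSetNatIso f, ?_⟩
  ext1; funext x
  exact FintypeCat.hom_ext _ _ fun w => rfl

end SemiGal

/-- `B_f π₁(C, F)` is naturally isomorphic to `⟨C, F⟩`. -/
noncomputable def finMSetFundMonoidIso :
    fundMonoidFunctor.{u} ⋙ finMSetFunctor.{u} ≅ 𝟭 SemiGal.{u}ᵒᵖ :=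
  NatIso.ofComponents (fun X => X.unop.toFinMSetExact.toIso.op) (by
    rintro ⟨Y⟩ ⟨X⟩ ⟨⟨f⟩⟩
    exact congrArg Quiver.Hom.op (Quotient.sound (SemiGal.toFinMSetExact_naturality f)).symm)

/-- The duality between profinite monoids and semi-galois categories. -/
noncomputable def finMSetEquivalence : ProfMon.{u} ≌ SemiGal.{u}ᵒᵖ :=
  CategoryTheory.Equivalence.mk finMSetFunctor fundMonoidFunctor fundMonoidFinMSetIso
    finMSetFundMonoidIso

theorem mainTheorem1 :
    -- `π₁` and `B_f` are equivalences of categories, mutually inverse up to natural isomorphism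
    fundMonoidFunctor.{u}.IsEquivalence ∧
    finMSetFunctor.{u}.IsEquivalence ∧
    Nonempty (finMSetFunctor.{u} ⋙ fundMonoidFunctor.{u} ≅ 𝟭 ProfMon.{u}) ∧
    Nonempty (fundMonoidFunctor.{u} ⋙ finMSetFunctor.{u} ≅ 𝟭 SemiGal.{u}ᵒᵖ) ∧
    -- `π₁(C, F)` is the inverse limit of the monoids `End(X)` over the galois objects `(X, ξ)`,
    -- as a topological monoid
    (∀ X : SemiGal.{u}, ∃ δ : galoisLimit X.F ≃ₜ* fundMonoidFunctor.obj (Opposite.op X),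
      ∀ (v : galoisLimit X.F) (Γ : GaloisObject X.F),
        (fundMonoidEquiv X (δ v)).eval Γ.X Γ.ξ = X.F.map (v.1 Γ) Γ.ξ) ∧
    -- galois categories correspond to profinite groups
    (∀ (C : Type (u + 1)) [Category.{u} C] [EssentiallySmall.{u} C] (F : C ⥤ FintypeCat.{u}),
      IsGaloisWithFiber F ↔
        ∃ h : IsSemiGalois F, (fundMonoidFunctor.obj (Opposite.op (SemiGal.mk C F h))).IsGroup) ∧
    (∀ M : ProfMon.{u}, M.IsGroup ↔ IsGaloisWithFiber (finMSetFunctor.obj M).unop.F) := by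
  have hgal : ∀ (C : Type (u + 1)) [Category.{u} C] [EssentiallySmall.{u} C]
      (F : C ⥤ FintypeCat.{u}), IsGaloisWithFiber F ↔
        ∃ h : IsSemiGalois F, (fundMonoid (SemiGal.mk C F h)).IsGroup := by
    intro C _ _ F
    refine ⟨?_, ?_⟩
    · rintro ⟨_, _⟩
      have h := FiberFunctor.isSemiGalois_of_galois F
      exact ⟨h, (ProfMon.IsGroup.congr (fundMonoidEquiv (SemiGal.mk C F h)).toMulEquiv).2
        FiberFunctor.isUnit_of_galois⟩
    · rintro ⟨h, hG⟩
      exact FiberFunctor.isGaloisWithFiber h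
        ((ProfMon.IsGroup.congr (fundMonoidEquiv (SemiGal.mk C F h)).toMulEquiv).1 hG)
  refine ⟨?_, ?_, ⟨fundMonoidFinMSetIso.symm⟩, ⟨finMSetFundMonoidIso⟩, fun X => ?_, hgal,
    fun M => ?_⟩
  · exact finMSetEquivalence.isEquivalence_inverse
  · exact finMSetEquivalence.isEquivalence_functor
  · have := X.isSemiGalois.hasFiniteLimits
    have := X.isSemiGalois.preservesFiniteLimits
    have := X.isSemiGalois.reflectsIsomorphisms
    obtain ⟨e, he⟩ := FiberFunctor.exists_galoisLimit_equiv (F := X.F)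
    refine ⟨e.symm.trans (fundMonoidEquiv X).symm, fun v Γ => ?_⟩
    have h : fundMonoidEquiv X ((fundMonoidEquiv X).symm (e.symm v)) = e.symm v :=
      (fundMonoidEquiv X).apply_symm_apply _
    have h2 := he (e.symm v) Γ
    rw [e.apply_symm_apply] at h2
    exact (congrArg (fun φ : FiberEnd X.F => φ.eval Γ.X Γ.ξ) h).trans h2.symm
  -- Invertibility passes from `M` to the natural endomorphisms of its forgetful functor, where both
  -- directions are already known.
  · have h1 : M.IsGroup ↔ ∀ φ : FiberEnd (FinMSet.fiber M), IsUnit φ :=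
      ProfMon.IsGroup.congr (FinMSet.actEndEquiv M).toMulEquiv
    refine h1.trans ⟨FiberFunctor.isGaloisWithFiber (FinMSet.isSemiGalois M), ?_⟩
    rintro ⟨h, h'⟩
    exact @FiberFunctor.isUnit_of_galois (FinMSet M) _ _ h h'
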